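/- Let $(X,d)$ be a connected proper metric space (closed bounded sets are compact) and let $\mu$ be a Borel-regular measure on $X$ with $\mu(X)=\infty$ and $0<\mu(B(x,r))<\infty$ for every open ball $B(x,r)=\{y\in X: d(x,y)<r\}$, $x\in X$, $0<r<\infty$. A Borel function $g:X\to[0,\infty]$ is an upper gradient of $u:X\to[-\infty,\infty]$ if $|u(y)-u(x)|\le\int_\gamma g\,ds$ for every non-constant compact rectifiable curve $\gamma$ in $X$ with endpoints $x,y$, where this is read as $\int_\gamma g\,ds=\infty$ if $|u(x)|=\infty$ or $|u(y)|=\infty$, and where $\int_\gamma g\,ds$ is the integral with respect to arc length. For $1\le p<\infty$, the Dirichlet class $D^{1,p}(X)$ consists of the measurable functions $f:X\to\mathbb R$ that have an upper gradient $g$ with $\int_X g^p\,d\mu<\infty$. Let $1\le p<s<\infty$ and let $q>1$ satisfy $\frac1q+\frac1s=\frac1p$. Suppose that 1. $\mu$ is Ahlfors $s$-regular: there is a constant $C\ge1$ such that $C^{-1}r^s\le\mu(B(x,r))\le C\,r^s$ for all $x\in X$ and $0<r<2\operatorname{diam}(X)$; 2. $(X,d,\mu)$ is of globally $p$-controlled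 geometry: there are constants $C_d\ge1$ and $C,\lambda>0$ such that for all $x\in X$ and $0<r<\infty$ we have $\mu(B(x,2r))\le C_d\,\mu(B(x,r))$, and for every $u\in L^1_{\mathrm{loc}}(X)$ and every upper gradient $g$ of $u$, $$\frac1{\mu(B(x,r))}\int_{B(x,r)}|u-u_{B(x,r)}|\,d\mu\le C\,r\left(\frac1{\mu(B(x,\lambda r))}\int_{B(x,\lambda r)}g^p\,d\mu\right)^{1/p},$$ where $u_B=\frac1{\mu(B)}\int_B u\,d\mu$. Then for every $f\in D^{1,p}(X)$ there is a constant $c\in\mathbb R$ (which may depend on $f$) such that $f-c\in L^q(X)$, that is, $\int_X|f-c|^q\,d\mu<\infty$. -/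

import Mathlib

open MeasureTheory Set
open scoped ENNReal

noncomputable section

namespace Dirichlet

variable {X : Type*} [MetricSpace X]

/-- `γ`, restricted to the compact interval `[a, b]`, is a non-constant rectifiable curve in `X`. -/
structure IsRectifiableCurve (γ : ℝ → X) (a b : ℝ) : Prop where
  le : a ≤ b
  continuousOn : ContinuousOn γ (Icc a b)
  finite_length : eVariationOn γ (Icc a b) ≠ ∞
  nonconstant : ∃ t ∈ Icc a b, γ t ≠ γ a

/-- The path integral `∫_γ g ds` of a nonnegative function along the curve `γ : [a, b] → X`:
the integral over `[0, ℓ(γ)]` of `g` composed with the arc-length parametrization of `γ`. -/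
def pathIntegral (g : X → ℝ≥0∞) (γ : ℝ → X) (a b : ℝ) : ℝ≥0∞ :=
  ∫⁻ t in Icc 0 (eVariationOn γ (Icc a b)).toReal, g (naturalParameterization γ (Icc a b) a t)

/-- The Borel function `g : X → [0, ∞]` is an upper gradient of `u : X → [-∞, ∞]`.
In `EReal` every difference with at least one infinite term is infinite (also `⊤ - ⊤` and `⊥ - ⊥`),
so that the inequality then says that the path integral is infinite. -/
def IsUpperGradient [MeasurableSpace X] (u : X → EReal) (g : X → ℝ≥0∞) : Prop :=
  Measurable g ∧ ∀ (γ : ℝ → X) (a b : ℝ), IsRectifiableCurve γ a b →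
    (u (γ b) - u (γ a)).abs ≤ pathIntegral g γ a b

variable [MeasurableSpace X]

/-- The Dirichlet class `D^{1,p}(X)`. -/
def MemDirichlet (p : ℝ) (μ : Measure X) (f : X → ℝ) : Prop :=
  AEMeasurable f μ ∧
    ∃ g : X → ℝ≥0∞, IsUpperGradient (fun x => (f x : EReal)) g ∧ ∫⁻ x, g x ^ p ∂μ < ∞

/-- The extended real valued function `u` is in `L^1_loc(X)`. -/
def MemL1loc (μ : Measure X) (u : X → EReal) : Prop :=
  (∀ᵐ x ∂μ, u x ≠ ⊤ ∧ u x ≠ ⊥) ∧ LocallyIntegrable (fun x => (u x).toReal) μ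

/-- The global doubling property. -/
def IsGloballyDoubling (μ : Measure X) : Prop :=
  ∃ Cd : ℝ, 1 ≤ Cd ∧ ∀ (x : X) (r : ℝ), 0 < r →
    μ (Metric.ball x (2 * r)) ≤ ENNReal.ofReal Cd * μ (Metric.ball x r)

/-- The global `p`-Poincaré inequality, for all function-upper gradient pairs `(u, g)` with
`u` in `L^1_loc(X)`. -/
def SupportsGlobalPoincare (p : ℝ) (μ : Measure X) : Prop :=
  ∃ C lam : ℝ, 0 < C ∧ 0 < lam ∧ ∀ (x : X) (r : ℝ), 0 < r →
    ∀ (u : X → EReal) (g : X → ℝ≥0∞), MemL1loc μ u → IsUpperGradient u g →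
      ⨍⁻ y in Metric.ball x r,
          ‖(u y).toReal - ⨍ z in Metric.ball x r, (u z).toReal ∂μ‖ₑ ∂μ ≤
        ENNReal.ofReal (C * r) * (⨍⁻ y in Metric.ball x (lam * r), g y ^ p ∂μ) ^ (1 / p)

/-- Globally `p`-controlled geometry. -/
def IsGloballyControlled (p : ℝ) (μ : Measure X) : Prop :=
  IsGloballyDoubling μ ∧ SupportsGlobalPoincare p μ

/-- Ahlfors `s`-regularity: `C⁻¹ r ^ s ≤ μ (B(x, r)) ≤ C r ^ s` for `0 < r < 2 diam X`. -/
def IsAhlforsRegular (s : ℝ) (μ : Measure X) : Prop :=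
  ∃ C : ℝ, 1 ≤ C ∧ ∀ (x : X) (r : ℝ), 0 < r →
    ENNReal.ofReal r < 2 * Metric.ediam (univ : Set X) →
      ENNReal.ofReal (C⁻¹ * r ^ s) ≤ μ (Metric.ball x r) ∧
        μ (Metric.ball x r) ≤ ENNReal.ofReal (C * r ^ s)

end Dirichlet

end

/-!
For a function `u` with a `p`-integrable upper gradient, the Poincaré inequality bounds the
difference of the averages of `u` over concentric balls of radii `r` and `2 r` by a multiple of
`r ^ (1 - s / p) = r ^ (-(s / q))`. Large radii therefore give averages that converge to a constant
`c` independent of the centre; telescoping over all dyadic radii and a Vitali covering give the weak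
type estimate `t ^ q * μ {t < |u - c|} ≤ K * (∫ g ^ p) ^ (q / p)`.

To reach the strong type, apply the weak type estimate to the truncations of `v = |f - c|` between
the levels `2 ^ (k - 1)` and `2 ^ k`. The upper gradient of a truncation may be localized to the
layer `{2 ^ (k - 1) < v < 2 ^ k}`, so that the energies of the truncations add up to at most that of
`f`. The constants of the truncations are known because `μ X = ∞`: each truncation equals
`2 ^ (k - 1)` off a set of finite measure.
-/

namespace Dirichlet

open Filter Topology Metric

section UnitSpeed

variable {E : Type*} [PseudoEMetricSpace E] {γ : ℝ → E} {S : Set ℝ}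

theorem continuousOn_variationOnFromTo (hγ : ContinuousOn γ S) (hV : BoundedVariationOn γ S)
    {a : ℝ} (ha : a ∈ S) : ContinuousOn (variationOnFromTo γ S a) S := by
  intro x hx
  have hl := hV.tendsto_eVariationOn_Icc_zero_left (x := x) ((hγ x hx).mono inter_subset_left)
  have hr := hV.tendsto_eVariationOn_Icc_zero_right x ((hγ x hx).mono inter_subset_left)
  have hsum := ((ENNReal.tendsto_toReal ENNReal.zero_ne_top).comp hl).add
    ((ENNReal.tendsto_toReal ENNReal.zero_ne_top).comp hr)
  simp only [ENNReal.toReal_zero, add_zero] at hsum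
  rw [ContinuousWithinAt, tendsto_iff_dist_tendsto_zero]
  refine squeeze_zero' (Eventually.of_forall fun _ => dist_nonneg) ?_ hsum
  filter_upwards [self_mem_nhdsWithin] with y hy
  rw [Real.dist_eq, variationOnFromTo.sub_right hV.locallyBoundedVariationOn ha hy hx]
  rcases le_total x y with h | h
  · rw [variationOnFromTo.eq_of_le _ _ h, abs_of_nonneg ENNReal.toReal_nonneg]
    exact le_add_of_nonneg_left ENNReal.toReal_nonneg
  · rw [variationOnFromTo.eq_of_ge _ _ h, abs_neg, abs_of_nonneg ENNReal.toReal_nonneg]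
    exact le_add_of_nonneg_right ENNReal.toReal_nonneg

theorem variationOnFromTo_Icc {a b : ℝ} (hab : a ≤ b) :
    variationOnFromTo γ (Icc a b) a b = (eVariationOn γ (Icc a b)).toReal := by
  rw [variationOnFromTo.eq_of_le _ _ hab, inter_self]

theorem image_variationOnFromTo_Icc {a b : ℝ} (hab : a ≤ b) (hγ : ContinuousOn γ (Icc a b))
    (hV : BoundedVariationOn γ (Icc a b)) :
    variationOnFromTo γ (Icc a b) a '' Icc a b = Icc 0 (eVariationOn γ (Icc a b)).toReal := by
  have ha := left_mem_Icc.2 hab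
  rw [← variationOnFromTo_Icc hab, ← variationOnFromTo.self γ (Icc a b) a]
  exact (continuousOn_variationOnFromTo hγ hV ha).image_Icc_of_monotoneOn hab
    (variationOnFromTo.monotoneOn hV.locallyBoundedVariationOn ha)

theorem eVariationOn_Icc_of_hasUnitSpeedOn (hγ : HasUnitSpeedOn γ S) {s t : ℝ} (hst : s ≤ t)
    (hS : Icc s t ⊆ S) : eVariationOn γ (Icc s t) = ENNReal.ofReal (t - s) := by
  have := hγ (hS (left_mem_Icc.2 hst)) (hS (right_mem_Icc.2 hst))
  rwa [NNReal.coe_one, one_mul, inter_eq_self_of_subset_right hS] at this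

theorem lipschitzOnWith_of_hasUnitSpeedOn (hγ : HasUnitSpeedOn γ S) : LipschitzOnWith 1 γ S := by
  have hle : ∀ s ∈ S, ∀ t ∈ S, s ≤ t → edist (γ s) (γ t) ≤ edist s t := by
    intro s hs t ht hst
    calc edist (γ s) (γ t) ≤ eVariationOn γ (S ∩ Icc s t) :=
          eVariationOn.edist_le γ ⟨hs, left_mem_Icc.2 hst⟩ ⟨ht, right_mem_Icc.2 hst⟩
      _ = edist s t := by
          rw [hγ hs ht, NNReal.coe_one, one_mul, edist_comm, edist_dist, Real.dist_eq,
            abs_of_nonneg (sub_nonneg.2 hst)]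
  intro s hs t ht
  rw [ENNReal.coe_one, one_mul]
  rcases le_total s t with h | h
  · exact hle s hs t ht h
  · rw [edist_comm, edist_comm s]
    exact hle t ht s hs h

end UnitSpeed

theorem naturalParameterization_Icc_of_hasUnitSpeedOn {E : Type*} [EMetricSpace E] {γ : ℝ → E}
    {S : Set ℝ} (hγ : HasUnitSpeedOn γ S) {s t τ : ℝ} (hS : Icc s t ⊆ S)
    (hτ : τ ∈ Icc 0 (t - s)) : naturalParameterization γ (Icc s t) s τ = γ (s + τ) := by
  have hst : s ≤ t := sub_nonneg.1 (hτ.1.trans hτ.2)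
  have hmem : s + τ ∈ Icc s t := ⟨by linarith [hτ.1], by linarith [hτ.2]⟩
  have hV : BoundedVariationOn γ (Icc s t) := by
    rw [BoundedVariationOn, eVariationOn_Icc_of_hasUnitSpeedOn hγ hst hS]
    exact ENNReal.ofReal_ne_top
  have hτ' : variationOnFromTo γ (Icc s t) s (s + τ) = τ := by
    have hsub : Icc s (s + τ) ⊆ Icc s t := Icc_subset_Icc_right hmem.2
    rw [variationOnFromTo.eq_of_le _ _ hmem.1, inter_eq_self_of_subset_right hsub,
      eVariationOn_Icc_of_hasUnitSpeedOn hγ hmem.1 (hsub.trans hS), add_sub_cancel_left,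
      ENNReal.toReal_ofReal hτ.1]
  have h := edist_naturalParameterization_eq_zero hV.locallyBoundedVariationOn
    (left_mem_Icc.2 hst) hmem
  rwa [hτ', edist_eq_zero] at h

theorem setLIntegral_Icc_comp_const_add (h : ℝ → ℝ≥0∞) (s t : ℝ) :
    ∫⁻ τ in Icc 0 (t - s), h (s + τ) = ∫⁻ τ in Icc s t, h τ := by
  have hpre : (fun τ => s + τ) ⁻¹' Icc s t = Icc 0 (t - s) := by
    rw [preimage_const_add_Icc, sub_self]
  rw [← hpre]
  exact (measurePreserving_add_left volume s).setLIntegral_comp_preimage_emb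
    (measurableEmbedding_addLeft s) h (Icc s t)

section Curves

variable {X : Type*} [MetricSpace X]

theorem IsRectifiableCurve.exists_hasUnitSpeedOn {γ : ℝ → X} {a b : ℝ}
    (h : IsRectifiableCurve γ a b) :
    ∃ (Γ : ℝ → X) (L : ℝ), 0 ≤ L ∧ HasUnitSpeedOn Γ (Icc 0 L) ∧ Γ 0 = γ a ∧ Γ L = γ b ∧
      ∀ g : X → ℝ≥0∞, pathIntegral g γ a b = ∫⁻ t in Icc 0 L, g (Γ t) := by
  have hV : BoundedVariationOn γ (Icc a b) := h.finite_length
  have ha := left_mem_Icc.2 h.le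
  have hunit := has_unit_speed_naturalParameterization γ hV.locallyBoundedVariationOn ha
  have hleft := edist_naturalParameterization_eq_zero hV.locallyBoundedVariationOn ha ha
  have hright := edist_naturalParameterization_eq_zero hV.locallyBoundedVariationOn ha
    (right_mem_Icc.2 h.le)
  rw [image_variationOnFromTo_Icc h.le h.continuousOn hV] at hunit
  rw [variationOnFromTo.self, edist_eq_zero] at hleft
  rw [variationOnFromTo_Icc h.le, edist_eq_zero] at hright
  exact ⟨_, _, ENNReal.toReal_nonneg, hunit, hleft, hright, fun g => rfl⟩

theorem isRectifiableCurve_of_hasUnitSpeedOn {γ : ℝ → X} {S : Set ℝ} (hγ : HasUnitSpeedOn γ S)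
    {s t : ℝ} (hst : s < t) (hS : Icc s t ⊆ S) : IsRectifiableCurve γ s t := by
  have hvar := eVariationOn_Icc_of_hasUnitSpeedOn hγ hst.le hS
  refine ⟨hst.le, (lipschitzOnWith_of_hasUnitSpeedOn hγ).continuousOn.mono hS,
    hvar.trans_ne ENNReal.ofReal_ne_top, ?_⟩
  by_contra! hconst
  have hzero : eVariationOn γ (Icc s t) = 0 := by
    apply eVariationOn.constant_on
    rintro _ ⟨x, hx, rfl⟩ _ ⟨y, hy, rfl⟩
    rw [hconst x hx, hconst y hy]
  rw [hvar, ENNReal.ofReal_eq_zero] at hzero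
  linarith

theorem pathIntegral_of_hasUnitSpeedOn {γ : ℝ → X} {S : Set ℝ} (hγ : HasUnitSpeedOn γ S)
    {s t : ℝ} (hst : s ≤ t) (hS : Icc s t ⊆ S) (g : X → ℝ≥0∞) :
    pathIntegral g γ s t = ∫⁻ τ in Icc s t, g (γ τ) := by
  rw [pathIntegral, eVariationOn_Icc_of_hasUnitSpeedOn hγ hst hS,
    ENNReal.toReal_ofReal (sub_nonneg.2 hst), ← setLIntegral_Icc_comp_const_add fun τ => g (γ τ)]
  refine setLIntegral_congr_fun measurableSet_Icc fun τ hτ => ?_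
  rw [naturalParameterization_Icc_of_hasUnitSpeedOn hγ hS hτ]

variable [MeasurableSpace X] {f : X → ℝ} {g : X → ℝ≥0∞}

theorem isUpperGradient_coe_iff :
    IsUpperGradient (fun x => (f x : EReal)) g ↔ Measurable g ∧ ∀ (γ : ℝ → X) (a b : ℝ),
      IsRectifiableCurve γ a b →
        ENNReal.ofReal |f (γ b) - f (γ a)| ≤ pathIntegral g γ a b := by
  simp only [IsUpperGradient, ← EReal.coe_sub, EReal.abs_def]

theorem IsUpperGradient.le_setLIntegral (hg : IsUpperGradient (fun x => (f x : EReal)) g)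
    {γ : ℝ → X} {S : Set ℝ} (hγ : HasUnitSpeedOn γ S) {s t : ℝ} (hst : s ≤ t)
    (hS : Icc s t ⊆ S) :
    ENNReal.ofReal |f (γ t) - f (γ s)| ≤ ∫⁻ τ in Icc s t, g (γ τ) := by
  rcases hst.eq_or_lt with rfl | hlt
  · rw [sub_self, abs_zero, ENNReal.ofReal_zero]
    exact zero_le
  · rw [← pathIntegral_of_hasUnitSpeedOn hγ hst hS]
    exact (isUpperGradient_coe_iff.1 hg).2 γ s t (isRectifiableCurve_of_hasUnitSpeedOn hγ hlt hS)

theorem IsUpperGradient.of_abs_sub_le (hg : IsUpperGradient (fun x => (f x : EReal)) g)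
    {u : X → ℝ} (h : ∀ x y, |u x - u y| ≤ |f x - f y|) :
    IsUpperGradient (fun x => (u x : EReal)) g := by
  rw [isUpperGradient_coe_iff] at hg ⊢
  exact ⟨hg.1, fun γ a b hγ => (ENNReal.ofReal_le_ofReal (h _ _)).trans (hg.2 γ a b hγ)⟩

end Curves

section Truncation

theorem continuousOn_of_le_setLIntegral {v : ℝ → ℝ} {h : ℝ → ℝ≥0∞} {a b : ℝ}
    (hfin : ∫⁻ τ in Icc a b, h τ ≠ ∞)
    (hv : ∀ s t, a ≤ s → s ≤ t → t ≤ b → ENNReal.ofReal |v t - v s| ≤ ∫⁻ τ in Icc s t, h τ) :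
    ContinuousOn v (Icc a b) := by
  intro x hx
  have hlength : Tendsto (fun y => volume.restrict (Icc a b) (uIcc x y)) (𝓝[Icc a b] x) (𝓝 0) := by
    have hlim : Tendsto (fun y => ENNReal.ofReal |y - x|) (𝓝[Icc a b] x) (𝓝 0) := by
      have hcont : Continuous fun y => ENNReal.ofReal |y - x| :=
        ENNReal.continuous_ofReal.comp (by fun_prop)
      simpa using (hcont.tendsto x).mono_left nhdsWithin_le_nhds
    refine tendsto_of_tendsto_of_tendsto_of_le_of_le tendsto_const_nhds hlim (fun _ => zero_le)
      fun y => ?_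
    exact (Measure.restrict_apply_le _ _).trans_eq Real.volume_interval
  rw [ContinuousWithinAt, tendsto_iff_edist_tendsto_0]
  refine tendsto_of_tendsto_of_tendsto_of_le_of_le' tendsto_const_nhds
    (tendsto_setLIntegral_zero hfin hlength) (Eventually.of_forall fun _ => zero_le) ?_
  filter_upwards [self_mem_nhdsWithin] with y hy
  rw [Measure.restrict_restrict measurableSet_uIcc,
    inter_eq_self_of_subset_left (uIcc_subset_Icc hx hy), edist_dist, Real.dist_eq]
  rcases le_total x y with hxy | hyx
  · rw [uIcc_of_le hxy]
    exact hv x y hx.1 hxy hy.2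
  · rw [uIcc_of_ge hyx, abs_sub_comm]
    exact hv y x hy.1 hyx hx.2

theorem exists_mapsTo_Ioo_of_continuousOn {α β : Type*} [ConditionallyCompleteLinearOrder α]
    [TopologicalSpace α] [OrderTopology α] [LinearOrder β] [TopologicalSpace β]
    [OrderClosedTopology β] {v : α → β} {a b : α} {c d : β} (hab : a ≤ b)
    (hv : ContinuousOn v (Icc a b)) (ha : v a ≤ c) (hb : d ≤ v b) :
    ∃ s t, a ≤ s ∧ s ≤ t ∧ t ≤ b ∧ v s ≤ c ∧ d ≤ v t ∧ MapsTo v (Ioo s t) (Ioo c d) := by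
  have hupper : IsCompact (Icc a b ∩ v ⁻¹' Ici d) :=
    isCompact_Icc.of_isClosed_subset (hv.preimage_isClosed_of_isClosed isClosed_Icc isClosed_Ici)
      inter_subset_left
  obtain ⟨t, ⟨ht, hvt⟩, hfirst⟩ := hupper.exists_isLeast ⟨b, right_mem_Icc.2 hab, hb⟩
  have hlower : IsCompact (Icc a t ∩ v ⁻¹' Iic c) :=
    isCompact_Icc.of_isClosed_subset
      ((hv.mono (Icc_subset_Icc_right ht.2)).preimage_isClosed_of_isClosed isClosed_Icc
        isClosed_Iic)
      inter_subset_left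
  obtain ⟨s, ⟨hs, hvs⟩, hlast⟩ := hlower.exists_isGreatest ⟨a, left_mem_Icc.2 ht.1, ha⟩
  refine ⟨s, t, hs.1, hs.2, ht.2, hvs, hvt, fun τ hτ => ⟨?_, ?_⟩⟩
  · by_contra! hle
    exact hτ.1.not_ge (hlast ⟨⟨hs.1.trans hτ.1.le, hτ.2.le⟩, hle⟩)
  · by_contra! hle
    exact hτ.2.not_ge (hfirst ⟨⟨hs.1.trans hτ.1.le, hτ.2.le.trans ht.2⟩, hle⟩)

theorem ofReal_projIcc_sub_le_setLIntegral {v : ℝ → ℝ} {h k : ℝ → ℝ≥0∞} {a b α β : ℝ}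
    (hab : a ≤ b) (hαβ : α ≤ β) (hcont : ContinuousOn v (Icc a b))
    (hv : ∀ s t, a ≤ s → s ≤ t → t ≤ b → ENNReal.ofReal |v t - v s| ≤ ∫⁻ τ in Icc s t, h τ)
    (hk : ∀ τ ∈ Icc a b, v τ ∈ Ioo α β → h τ ≤ k τ) :
    ENNReal.ofReal (projIcc α β hαβ (v b) - projIcc α β hαβ (v a)) ≤ ∫⁻ τ in Icc a b, k τ := by
  set c := (projIcc α β hαβ (v a) : ℝ) with hc
  set d := (projIcc α β hαβ (v b) : ℝ) with hd
  rcases le_or_gt d c with hdc | hcd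
  · rw [ENNReal.ofReal_of_nonpos (sub_nonpos.2 hdc)]
    exact zero_le
  have hα : α ≤ c := (projIcc α β hαβ (v a)).2.1
  have hβ : d ≤ β := (projIcc α β hαβ (v b)).2.2
  have hva : v a ≤ c := by
    rw [coe_projIcc] at hc
    grind
  have hvb : d ≤ v b := by
    rw [coe_projIcc] at hd
    grind
  obtain ⟨s, t, has, hst, htb, hvs, hvt, hmaps⟩ :=
    exists_mapsTo_Ioo_of_continuousOn hab hcont hva hvb
  calc ENNReal.ofReal (d - c) ≤ ENNReal.ofReal |v t - v s| :=
        ENNReal.ofReal_le_ofReal (le_abs.2 (Or.inl (sub_le_sub hvt hvs)))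
    _ ≤ ∫⁻ τ in Icc s t, h τ := hv s t has hst htb
    _ = ∫⁻ τ in Ioo s t, h τ := setLIntegral_congr Ioo_ae_eq_Icc.symm
    _ ≤ ∫⁻ τ in Ioo s t, k τ := setLIntegral_mono' measurableSet_Ioo fun τ hτ =>
        hk τ ⟨has.trans hτ.1.le, hτ.2.le.trans htb⟩ (Ioo_subset_Ioo hα hβ (hmaps hτ))
    _ ≤ ∫⁻ τ in Icc a b, k τ :=
        lintegral_mono_set (Ioo_subset_Icc_self.trans (Icc_subset_Icc has htb))

theorem coe_projIcc_neg {α β : ℝ} (hαβ : α ≤ β) (x : ℝ) :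
    (projIcc (-β) (-α) (neg_le_neg hαβ) (-x) : ℝ) = -projIcc α β hαβ x := by
  rw [coe_projIcc, coe_projIcc, min_neg_neg, max_neg_neg, max_min_distrib_left, max_eq_right hαβ,
    min_comm, max_comm α]

theorem ofReal_abs_projIcc_sub_le_setLIntegral {v : ℝ → ℝ} {h k : ℝ → ℝ≥0∞} {a b α β : ℝ}
    (hab : a ≤ b) (hαβ : α ≤ β) (hcont : ContinuousOn v (Icc a b))
    (hv : ∀ s t, a ≤ s → s ≤ t → t ≤ b → ENNReal.ofReal |v t - v s| ≤ ∫⁻ τ in Icc s t, h τ)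
    (hk : ∀ τ ∈ Icc a b, v τ ∈ Ioo α β → h τ ≤ k τ) :
    ENNReal.ofReal |(projIcc α β hαβ (v b) - projIcc α β hαβ (v a) : ℝ)| ≤
      ∫⁻ τ in Icc a b, k τ := by
  rw [abs_eq_max_neg, ENNReal.ofReal_max, max_le_iff]
  refine ⟨ofReal_projIcc_sub_le_setLIntegral hab hαβ hcont hv hk, ?_⟩
  rw [neg_sub', ← coe_projIcc_neg, ← coe_projIcc_neg]
  refine ofReal_projIcc_sub_le_setLIntegral (v := fun t => -v t) (h := h) hab (neg_le_neg hαβ)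
    hcont.neg (fun s t hs hst ht => ?_) fun τ hτ hvτ => ?_
  · rw [neg_sub_neg, abs_sub_comm]
    exact hv s t hs hst ht
  · exact hk τ hτ ⟨neg_lt_neg_iff.1 hvτ.2, neg_lt_neg_iff.1 hvτ.1⟩

variable {X : Type*} [MetricSpace X] [MeasurableSpace X] {f : X → ℝ} {g : X → ℝ≥0∞}

theorem IsUpperGradient.truncate [BorelSpace X] (hg : IsUpperGradient (fun x => (f x : EReal)) g)
    {α β : ℝ} (hαβ : α ≤ β) {A : Set X} (hA : MeasurableSet A) (hsub : f ⁻¹' Ioo α β ⊆ A)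
    {ε : ℝ≥0∞} (hε : ε ≠ 0) :
    IsUpperGradient (fun x => ((projIcc α β hαβ (f x) : ℝ) : EReal))
      (fun x => A.indicator g x + ε * g x) := by
  have hgm := hg.1
  refine isUpperGradient_coe_iff.2 ⟨(hgm.indicator hA).add (hgm.const_mul ε), ?_⟩
  intro γ a b hγ
  obtain ⟨Γ, L, hL, hunit, hΓ0, hΓL, hpath⟩ := hγ.exists_hasUnitSpeedOn
  rw [hpath, ← hΓ0, ← hΓL]
  -- The summand `ε * g` makes the path integral infinite whenever that of `g` is.
  rcases eq_or_ne (∫⁻ τ in Icc 0 L, g (Γ τ)) ∞ with htop | hfin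
  · have hgΓ : AEMeasurable (fun τ => g (Γ τ)) (volume.restrict (Icc 0 L)) :=
      hgm.comp_aemeasurable
        ((lipschitzOnWith_of_hasUnitSpeedOn hunit).continuousOn.aemeasurable measurableSet_Icc)
    calc _ ≤ ε * ∫⁻ τ in Icc 0 L, g (Γ τ) := by rw [htop, ENNReal.mul_top hε]; exact le_top
      _ = ∫⁻ τ in Icc 0 L, ε * g (Γ τ) := (lintegral_const_mul'' _ hgΓ).symm
      _ ≤ _ := lintegral_mono fun τ => le_add_self
  · have hinc : ∀ s t, 0 ≤ s → s ≤ t → t ≤ L →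
        ENNReal.ofReal |f (Γ t) - f (Γ s)| ≤ ∫⁻ τ in Icc s t, g (Γ τ) :=
      fun s t hs hst ht => hg.le_setLIntegral hunit hst (Icc_subset_Icc hs ht)
    refine ofReal_abs_projIcc_sub_le_setLIntegral hL hαβ
      (continuousOn_of_le_setLIntegral hfin hinc) hinc fun τ _ hτ => ?_
    rw [indicator_of_mem (hsub hτ)]
    exact le_self_add

theorem lintegral_rpow_indicator_add_const_mul_le {Y : Type*} [MeasurableSpace Y] (μ : Measure Y)
    {g : Y → ℝ≥0∞} {A : Set Y} (hA : MeasurableSet A) {p : ℝ} (hp : 0 ≤ p) {ε : ℝ≥0∞}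
    (hε : ε ≠ ∞) :
    ∫⁻ x, (A.indicator g x + ε * g x) ^ p ∂μ ≤
      (1 + ε) ^ p * ∫⁻ x in A, g x ^ p ∂μ + ε ^ p * ∫⁻ x, g x ^ p ∂μ := by
  have hA_le : ∫⁻ x in A, (A.indicator g x + ε * g x) ^ p ∂μ =
      (1 + ε) ^ p * ∫⁻ x in A, g x ^ p ∂μ := by
    rw [← lintegral_const_mul' _ _ (ENNReal.rpow_ne_top_of_nonneg hp (by finiteness))]
    refine setLIntegral_congr_fun hA fun x hx => ?_
    rw [indicator_of_mem hx, ← one_add_mul, ENNReal.mul_rpow_of_nonneg _ _ hp]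
  have hA_compl : ∫⁻ x in Aᶜ, (A.indicator g x + ε * g x) ^ p ∂μ ≤
      ε ^ p * ∫⁻ x, g x ^ p ∂μ := by
    rw [← lintegral_const_mul' _ _ (ENNReal.rpow_ne_top_of_nonneg hp hε)]
    refine (setLIntegral_mono' hA.compl fun x hx => ?_).trans (setLIntegral_le_lintegral _ _)
    rw [indicator_of_notMem hx, zero_add, ENNReal.mul_rpow_of_nonneg _ _ hp]
  rw [← lintegral_add_compl _ hA, hA_le]
  exact add_le_add_right hA_compl _

end Truncation

section AhlforsRegular

theorem secondCountableTopology_of_sFinite_of_isOpenPosMeasure {X : Type*} [PseudoMetricSpace X]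
    [MeasurableSpace X] [OpensMeasurableSpace X] (μ : Measure X) [SFinite μ]
    [μ.IsOpenPosMeasure] : SecondCountableTopology X := by
  refine secondCountable_of_almost_dense_set fun ε hε => ?_
  obtain ⟨u, -, hdisj, hcov⟩ := Vitali.exists_disjoint_subfamily_covering_enlargement_closedBall
    univ (fun x : X => x) (fun _ => ε / 5) (ε / 5) (fun _ _ => le_rfl) 5 (by norm_num)
  have hpos : ∀ x : u, 0 < μ (closedBall (x : X) (ε / 5)) := fun x =>
    measure_closedBall_pos μ x (by positivity)
  have hcount := Measure.countable_meas_pos_of_disjoint_iUnion (μ := μ)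
    (As := fun x : u => closedBall (x : X) (ε / 5)) (fun _ => measurableSet_closedBall)
    fun x y hxy => hdisj x.2 y.2 (Subtype.coe_ne_coe.2 hxy)
  refine ⟨u, ?_, fun x => ?_⟩
  · simpa only [hpos, ofPred_true, countable_univ_iff, countable_coe_iff] using hcount
  · obtain ⟨y, hy, hsub⟩ := hcov x (mem_univ x)
    have hxy := mem_closedBall.1 (hsub (mem_closedBall_self (by positivity)))
    exact ⟨y, hy, by linarith⟩

variable {X : Type*} [MetricSpace X] [MeasurableSpace X] {μ : Measure X} {s A : ℝ}

/-- Ahlfors `s`-regularity with constant `A` at all scales, the form that `IsAhlforsRegular` takes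
on an unbounded space. -/
structure IsGloballyAhlforsRegular (s A : ℝ) (μ : Measure X) : Prop where
  pos : 0 < A
  le_measure_ball (x : X) {r : ℝ} (hr : 0 < r) : ENNReal.ofReal (A⁻¹ * r ^ s) ≤ μ (ball x r)
  measure_ball_le (x : X) {r : ℝ} (hr : 0 < r) : μ (ball x r) ≤ ENNReal.ofReal (A * r ^ s)

theorem IsAhlforsRegular.ediam_univ_eq_top [Nontrivial X] (hμ : IsAhlforsRegular s μ)
    (hμ_univ : μ univ = ∞) : ediam (univ : Set X) = ∞ := by
  by_contra hfin
  obtain ⟨A, -, hA⟩ := hμ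
  obtain ⟨x⟩ : Nonempty X := inferInstance
  have hdiam : 0 < (ediam (univ : Set X)).toReal :=
    ENNReal.toReal_pos (ediam_pos_iff.2 nontrivial_univ).ne' hfin
  set D := (ediam (univ : Set X)).toReal with hD
  have hball : ball x (3 / 2 * D) = univ := eq_univ_of_forall fun y => by
    have hle : dist y x ≤ D := by
      rw [dist_edist]
      exact ENNReal.toReal_mono hfin (edist_le_ediam_of_mem (mem_univ y) (mem_univ x))
    rw [mem_ball]
    linarith
  have hr : ENNReal.ofReal (3 / 2 * D) < 2 * ediam (univ : Set X) := by
    rw [← ENNReal.ofReal_toReal hfin, ← hD, ← ENNReal.ofReal_ofNat 2,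
      ← ENNReal.ofReal_mul zero_le_two]
    exact (ENNReal.ofReal_lt_ofReal_iff (by positivity)).2 (by linarith)
  have hle := (hA x (3 / 2 * D) (by positivity) hr).2
  rw [hball, hμ_univ] at hle
  exact ENNReal.ofReal_ne_top (top_le_iff.1 hle)

theorem IsAhlforsRegular.exists_isGloballyAhlforsRegular [Nontrivial X]
    (hμ : IsAhlforsRegular s μ) (hμ_univ : μ univ = ∞) : ∃ A, IsGloballyAhlforsRegular s A μ := by
  have hsmall : ∀ r, ENNReal.ofReal r < 2 * ediam (univ : Set X) := fun r => by
    rw [hμ.ediam_univ_eq_top hμ_univ, ENNReal.mul_top two_ne_zero]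
    exact ENNReal.ofReal_lt_top
  obtain ⟨A, hA1, hA⟩ := hμ
  exact ⟨A, by linarith, fun x r hr => (hA x r hr (hsmall r)).1,
    fun x r hr => (hA x r hr (hsmall r)).2⟩

namespace IsGloballyAhlforsRegular

variable (hμ : IsGloballyAhlforsRegular s A μ)
include hμ

theorem measure_ball_pos (x : X) {r : ℝ} (hr : 0 < r) : 0 < μ (ball x r) :=
  have := hμ.pos
  (ENNReal.ofReal_pos.2 (by positivity)).trans_le (hμ.le_measure_ball x hr)

theorem measure_ball_lt_top (x : X) (r : ℝ) : μ (ball x r) < ∞ := by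
  rcases lt_or_ge 0 r with hr | hr
  · exact (hμ.measure_ball_le x hr).trans_lt ENNReal.ofReal_lt_top
  · rw [ball_eq_empty.2 hr, measure_empty]
    exact ENNReal.zero_lt_top

theorem isLocallyFiniteMeasure : IsLocallyFiniteMeasure μ :=
  ⟨fun x => ⟨ball x 1, ball_mem_nhds x one_pos, hμ.measure_ball_lt_top x 1⟩⟩

theorem isOpenPosMeasure : μ.IsOpenPosMeasure where
  open_pos _ hU hne := by
    obtain ⟨x, hx⟩ := hne
    obtain ⟨r, hr, hsub⟩ := isOpen_iff.1 hU x hx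
    exact ((hμ.measure_ball_pos x hr).trans_le (measure_mono hsub)).ne'

theorem sigmaFinite : SigmaFinite μ := by
  rcases isEmpty_or_nonempty X with hX | ⟨⟨x⟩⟩
  · rw [Measure.eq_zero_of_isEmpty μ]
    infer_instance
  · exact ⟨⟨⟨fun n => ball x n, fun _ => trivial, fun n => hμ.measure_ball_lt_top x n,
      iUnion_ball_nat x⟩⟩⟩

theorem secondCountableTopology [BorelSpace X] : SecondCountableTopology X :=
  have := hμ.sigmaFinite
  have := hμ.isOpenPosMeasure
  secondCountableTopology_of_sFinite_of_isOpenPosMeasure μ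

theorem isUnifLocDoublingMeasure : IsUnifLocDoublingMeasure μ := by
  have hA := hμ.pos
  refine ⟨⟨(A ^ 2 * 4 ^ s).toNNReal, ?_⟩⟩
  filter_upwards [self_mem_nhdsWithin] with r (hr : 0 < r) x
  calc μ (closedBall x (2 * r)) ≤ μ (ball x (4 * r)) :=
        measure_mono (closedBall_subset_ball (by linarith))
    _ ≤ ENNReal.ofReal (A * (4 * r) ^ s) := hμ.measure_ball_le x (by positivity)
    _ = ENNReal.ofReal (A ^ 2 * 4 ^ s) * ENNReal.ofReal (A⁻¹ * r ^ s) := by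
        rw [← ENNReal.ofReal_mul (by positivity), Real.mul_rpow (by norm_num) hr.le]
        congr 1
        field_simp
    _ ≤ ENNReal.ofReal (A ^ 2 * 4 ^ s) * μ (closedBall x r) := by
        gcongr
        exact (hμ.le_measure_ball x hr).trans (measure_mono ball_subset_closedBall)

end IsGloballyAhlforsRegular

end AhlforsRegular

section Averages

theorem edist_average_le_div_mul_laverage {α : Type*} [MeasurableSpace α] {μ : Measure α}
    {E B : Set α} {u : α → ℝ} (hEB : E ⊆ B) (hE : μ E ≠ 0) (hB : μ B ≠ ∞)
    (hu : IntegrableOn u E μ) (a : ℝ) :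
    edist (⨍ x in E, u x ∂μ) a ≤ μ B / μ E * ⨍⁻ x in B, ‖u x - a‖ₑ ∂μ := by
  have hE_fin : μ E ≠ ∞ := measure_ne_top_of_subset hEB hB
  have hfin : IsFiniteMeasure (μ.restrict E) := ⟨by simpa using hE_fin.lt_top⟩
  have hne : NeZero (μ.restrict E) := ⟨by simpa using hE⟩
  have hint : Integrable u ((μ.restrict E univ)⁻¹ • μ.restrict E) :=
    hu.smul_measure (by simpa using hE)
  have hsub : (⨍ x in E, u x ∂μ) - a = ⨍ x in E, (u x - a) ∂μ := by
    conv_lhs => rw [← average_const (μ.restrict E) a]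
    exact (integral_sub hint (integrable_const a)).symm
  calc edist (⨍ x in E, u x ∂μ) a = ‖⨍ x in E, (u x - a) ∂μ‖ₑ := by rw [edist_eq_enorm_sub, hsub]
    _ ≤ ⨍⁻ x in E, ‖u x - a‖ₑ ∂μ := enorm_integral_le_lintegral_enorm _
    _ ≤ (∫⁻ x in B, ‖u x - a‖ₑ ∂μ) / μ E := by
        rw [setLAverage_eq]
        gcongr
    _ = μ B / μ E * ⨍⁻ x in B, ‖u x - a‖ₑ ∂μ := by
        rw [← measure_mul_setLAverage _ hB, ENNReal.mul_div_right_comm]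

variable {X : Type*} [MetricSpace X] [MeasurableSpace X] {μ : Measure X} {p q s A C lam : ℝ}
  {u : X → ℝ} {g : X → ℝ≥0∞}

theorem IsGloballyAhlforsRegular.measure_ball_div_measure_closedBall_le
    (hμ : IsGloballyAhlforsRegular s A μ) (x y : X) {r R κ : ℝ} (hr : 0 < r) (hR : 0 < R)
    (hκ : R ≤ κ * r) :
    μ (ball y R) / μ (closedBall x r) ≤ ENNReal.ofReal (A ^ 2 * κ ^ s) := by
  have hA := hμ.pos
  have hκ_pos : 0 < κ := pos_of_mul_pos_left (hR.trans_le hκ) hr.le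
  calc μ (ball y R) / μ (closedBall x r)
      ≤ ENNReal.ofReal (A * (κ * r) ^ s) / ENNReal.ofReal (A⁻¹ * r ^ s) := by
        gcongr
        · exact (measure_mono (ball_subset_ball hκ)).trans (hμ.measure_ball_le y (by positivity))
        · exact (hμ.le_measure_ball x hr).trans (measure_mono ball_subset_closedBall)
    _ = ENNReal.ofReal (A ^ 2 * κ ^ s) := by
        rw [← ENNReal.ofReal_div_of_pos (by positivity), Real.mul_rpow hκ_pos.le hr.le]
        congr 1
        field_simp

theorem IsGloballyAhlforsRegular.laverage_ball_le (hμ : IsGloballyAhlforsRegular s A μ) (x : X)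
    {r : ℝ} (hr : 0 < r) (h : X → ℝ≥0∞) :
    ⨍⁻ y in ball x r, h y ∂μ ≤ ENNReal.ofReal (A * r ^ (-s)) * ∫⁻ y in ball x r, h y ∂μ := by
  have hA := hμ.pos
  rw [setLAverage_eq, ENNReal.div_eq_inv_mul, Real.rpow_neg hr.le, ← inv_inv A, ← mul_inv,
    ENNReal.ofReal_inv_of_pos (by positivity)]
  gcongr
  exact hμ.le_measure_ball x hr

/-- The `p`-Poincaré inequality, with constants `C` and `lam`, for the single pair `(u, g)`.
Integrability of `u` on balls is included, as otherwise the mean values are junk. -/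
structure IsPoincarePair (p C lam : ℝ) (μ : Measure X) (u : X → ℝ) (g : X → ℝ≥0∞) : Prop where
  integrableOn_ball (x : X) (r : ℝ) : IntegrableOn u (ball x r) μ
  laverage_le (x : X) {r : ℝ} (hr : 0 < r) :
    ⨍⁻ y in ball x r, ‖u y - ⨍ z in ball x r, u z ∂μ‖ₑ ∂μ ≤
      ENNReal.ofReal (C * r) * (⨍⁻ y in ball x (lam * r), g y ^ p ∂μ) ^ (1 / p)

/-- The constant in the comparison of the averages over a ball of radius `r` and over a ball of
radius `R` containing it, up to the factor `(R / r) ^ s`. -/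
noncomputable def oscillationConst (p s A C lam : ℝ) : ℝ :=
  A ^ 2 * C * (A * lam ^ (-s)) ^ (1 / p)

theorem oscillationConst_pos (hA : 0 < A) (hC : 0 < C) (hlam : 0 < lam) :
    0 < oscillationConst p s A C lam := by
  unfold oscillationConst
  positivity

theorem one_sub_div_eq_neg_div_of_holderTriple (h : q.HolderTriple s p) :
    1 - s / p = -(s / q) := by
  have := h.symm.pos
  rw [div_eq_mul_inv s p, ← h.inv_add_inv_eq_inv]
  field_simp
  ring

theorem two_rpow_neg_div_lt_one (h : q.HolderTriple s p) : (2 : ℝ) ^ (-(s / q)) < 1 :=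
  Real.rpow_lt_one_of_one_lt_of_neg one_lt_two (neg_lt_zero.2 (div_pos h.symm.pos h.pos))

theorem mul_laverage_rpow_le (hμ : IsGloballyAhlforsRegular s A μ) (h : q.HolderTriple s p)
    (hC : 0 < C) (hlam : 0 < lam) (x : X) {R : ℝ} (hR : 0 < R) :
    ENNReal.ofReal (C * R) * (⨍⁻ y in ball x (lam * R), g y ^ p ∂μ) ^ (1 / p) ≤
      ENNReal.ofReal (C * (A * lam ^ (-s)) ^ (1 / p) * R ^ (-(s / q))) *
        (∫⁻ y in ball x (lam * R), g y ^ p ∂μ) ^ (1 / p) := by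
  have hA := hμ.pos
  have hp := h.pos'
  have hexp : R * (R ^ (-s)) ^ (1 / p) = R ^ (-(s / q)) := by
    rw [← one_sub_div_eq_neg_div_of_holderTriple h, ← Real.rpow_mul hR.le, mul_comm R,
      ← Real.rpow_add_one hR.ne']
    congr 1
    ring
  calc ENNReal.ofReal (C * R) * (⨍⁻ y in ball x (lam * R), g y ^ p ∂μ) ^ (1 / p)
      ≤ ENNReal.ofReal (C * R) * (ENNReal.ofReal (A * (lam * R) ^ (-s)) *
          ∫⁻ y in ball x (lam * R), g y ^ p ∂μ) ^ (1 / p) := by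
        gcongr
        exact hμ.laverage_ball_le x (by positivity) _
    _ = _ := by
        rw [ENNReal.mul_rpow_of_nonneg _ _ (by positivity),
          ENNReal.ofReal_rpow_of_nonneg (by positivity) (by positivity), ← mul_assoc,
          ← ENNReal.ofReal_mul (by positivity), Real.mul_rpow hlam.le hR.le, ← mul_assoc,
          Real.mul_rpow (x := A * lam ^ (-s)) (by positivity) (by positivity), ← hexp]
        ring_nf

namespace IsPoincarePair

variable (hug : IsPoincarePair p C lam μ u g)
include hug

theorem edist_average_closedBall_average_ball_le (hμ : IsGloballyAhlforsRegular s A μ)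
    (h : q.HolderTriple s p) (hC : 0 < C) (hlam : 0 < lam) {x y : X} {r R κ : ℝ} (hr : 0 < r)
    (hR : 0 < R) (hsub : closedBall x r ⊆ ball y R) (hκ : R ≤ κ * r) :
    edist (⨍ z in closedBall x r, u z ∂μ) (⨍ z in ball y R, u z ∂μ) ≤
      ENNReal.ofReal (oscillationConst p s A C lam * κ ^ s * R ^ (-(s / q))) *
        (∫⁻ z in ball y (lam * R), g z ^ p ∂μ) ^ (1 / p) := by
  have hA := hμ.pos
  have hκ_pos : 0 < κ := pos_of_mul_pos_left (hR.trans_le hκ) hr.le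
  have hpos : μ (closedBall x r) ≠ 0 :=
    ((hμ.measure_ball_pos x hr).trans_le (measure_mono ball_subset_closedBall)).ne'
  refine (edist_average_le_div_mul_laverage hsub hpos (hμ.measure_ball_lt_top y R).ne
    ((hug.integrableOn_ball y R).mono_set hsub) _).trans ?_
  refine (mul_le_mul' (hμ.measure_ball_div_measure_closedBall_le x y hr hR hκ)
    ((hug.laverage_le y hR).trans (mul_laverage_rpow_le hμ h hC hlam y hR))).trans_eq ?_
  rw [← mul_assoc, ← ENNReal.ofReal_mul (by positivity), oscillationConst]
  ring_nf

theorem edist_average_closedBall_le (hμ : IsGloballyAhlforsRegular s A μ)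
    (h : q.HolderTriple s p) (hC : 0 < C) (hlam : 0 < lam) {x x' y : X} {r r' R κ : ℝ}
    (hr : 0 < r) (hr' : 0 < r') (hR : 0 < R) (hsub : closedBall x r ⊆ ball y R)
    (hsub' : closedBall x' r' ⊆ ball y R) (hκ : R ≤ κ * r) (hκ' : R ≤ κ * r') :
    edist (⨍ z in closedBall x r, u z ∂μ) (⨍ z in closedBall x' r', u z ∂μ) ≤
      ENNReal.ofReal (2 * oscillationConst p s A C lam * κ ^ s * R ^ (-(s / q))) *
        (∫⁻ z in ball y (lam * R), g z ^ p ∂μ) ^ (1 / p) := by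
  refine (edist_triangle_right _ _ (⨍ z in ball y R, u z ∂μ)).trans
    ((add_le_add (hug.edist_average_closedBall_average_ball_le hμ h hC hlam hr hR hsub hκ)
      (hug.edist_average_closedBall_average_ball_le hμ h hC hlam hr' hR hsub' hκ')).trans_eq ?_)
  rw [← two_mul, ← mul_assoc, ← ENNReal.ofReal_ofNat 2, ← ENNReal.ofReal_mul zero_le_two]
  ring_nf

theorem exists_edist_average_le_geometric (hμ : IsGloballyAhlforsRegular s A μ)
    (h : q.HolderTriple s p) (hC : 0 < C) (hlam : 0 < lam) (hg : ∫⁻ z, g z ^ p ∂μ ≠ ∞) (x x' : X)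
    {ρ ρ' : ℝ} (hρ : 0 < ρ) (hρ' : 0 < ρ') :
    ∃ K : ℝ≥0∞, K ≠ ∞ ∧ ∀ n : ℕ,
      edist (⨍ z in closedBall x (ρ * 2 ^ n), u z ∂μ)
        (⨍ z in closedBall x' (ρ' * 2 ^ n), u z ∂μ) ≤ K * ENNReal.ofReal (2 ^ (-(s / q))) ^ n := by
  have hp := h.pos'
  set M := ρ + ρ' + dist x x'
  have hM : 0 < M := by positivity
  set κ := M / ρ + M / ρ'
  refine ⟨ENNReal.ofReal (2 * oscillationConst p s A C lam * κ ^ s * M ^ (-(s / q))) *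
    (∫⁻ z, g z ^ p ∂μ) ^ (1 / p), by finiteness, fun n => ?_⟩
  have htwo : (1 : ℝ) ≤ 2 ^ n := one_le_pow₀ one_le_two
  have hsub : closedBall x (ρ * 2 ^ n) ⊆ ball x' (M * 2 ^ n) :=
    closedBall_subset_ball' (by nlinarith [dist_nonneg (x := x) (y := x')])
  have hsub' : closedBall x' (ρ' * 2 ^ n) ⊆ ball x' (M * 2 ^ n) :=
    closedBall_subset_ball (by nlinarith [dist_nonneg (x := x) (y := x')])
  have hκ : M * 2 ^ n ≤ κ * (ρ * 2 ^ n) := by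
    rw [← mul_assoc]
    gcongr
    exact (div_le_iff₀ hρ).1 (le_add_of_nonneg_right (by positivity))
  have hκ' : M * 2 ^ n ≤ κ * (ρ' * 2 ^ n) := by
    rw [← mul_assoc]
    gcongr
    exact (div_le_iff₀ hρ').1 (le_add_of_nonneg_left (by positivity))
  refine (hug.edist_average_closedBall_le hμ h hC hlam (by positivity) (by positivity)
    (by positivity) hsub hsub' hκ hκ').trans ?_
  rw [Real.mul_rpow hM.le (by positivity), ← Real.rpow_pow_comm zero_le_two, ← mul_assoc,
    ENNReal.ofReal_mul' (by positivity), ENNReal.ofReal_pow (by positivity), mul_right_comm]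
  gcongr
  exact Measure.restrict_le_self

theorem exists_tendsto_average [Nonempty X] (hμ : IsGloballyAhlforsRegular s A μ)
    (h : q.HolderTriple s p) (hC : 0 < C) (hlam : 0 < lam) (hg : ∫⁻ z, g z ^ p ∂μ ≠ ∞) :
    ∃ c : ℝ, ∀ (x : X) {ρ : ℝ}, 0 < ρ →
      Tendsto (fun n : ℕ => ⨍ z in closedBall x (ρ * 2 ^ n), u z ∂μ) atTop (𝓝 c) := by
  obtain ⟨x₀⟩ := ‹Nonempty X›
  have hratio : ENNReal.ofReal (2 ^ (-(s / q))) < 1 :=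
    ENNReal.ofReal_lt_one.2 (two_rpow_neg_div_lt_one h)
  obtain ⟨K, hK, hdist⟩ :=
    hug.exists_edist_average_le_geometric hμ h hC hlam hg x₀ x₀ one_pos two_pos
  obtain ⟨c, hc⟩ := cauchySeq_tendsto_of_complete (cauchySeq_of_edist_le_geometric
    (f := fun n : ℕ => ⨍ z in closedBall x₀ (1 * 2 ^ n), u z ∂μ) _ K hratio hK fun n => by
      simpa only [one_mul, pow_succ' (2 : ℝ)] using hdist n)
  refine ⟨c, fun x ρ hρ => tendsto_iff_edist_tendsto_0.2 ?_⟩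
  obtain ⟨K', hK', hdist'⟩ := hug.exists_edist_average_le_geometric hμ h hC hlam hg x x₀ hρ one_pos
  refine tendsto_of_tendsto_of_tendsto_of_le_of_le tendsto_const_nhds ?_ (fun _ => zero_le)
    fun n => (edist_triangle _ _ _).trans (add_le_add_left (hdist' n) _)
  simpa using (ENNReal.Tendsto.const_mul (ENNReal.tendsto_pow_atTop_nhds_zero_of_lt_one hratio)
    (.inr hK')).add (tendsto_iff_edist_tendsto_0.1 hc)

end IsPoincarePair

end Averages

section WeakType

variable {X : Type*} [MetricSpace X] [MeasurableSpace X] {μ : Measure X} {p q s A C lam : ℝ}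
  {u : X → ℝ} {g : X → ℝ≥0∞}

/-- The constant in the comparison of the averages over two concentric balls with ratio `2`. -/
noncomputable def dyadicConst (p q s A C lam : ℝ) : ℝ :=
  2 * oscillationConst p s A C lam * 4 ^ s * 4 ^ (-(s / q))

/-- The constant in the comparison of `u x` with the average of `u` at infinity. -/
noncomputable def weakTypeConst (p q s A C lam : ℝ) : ℝ :=
  dyadicConst p q s A C lam * ((4 * lam) ^ (s / p) + (1 - 2 ^ (-(s / q)))⁻¹)

theorem dyadicConst_pos (hA : 0 < A) (hC : 0 < C) (hlam : 0 < lam) :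
    0 < dyadicConst p q s A C lam := by
  have := oscillationConst_pos (p := p) (s := s) hA hC hlam
  unfold dyadicConst
  positivity

theorem weakTypeConst_pos (h : q.HolderTriple s p) (hA : 0 < A) (hC : 0 < C) (hlam : 0 < lam) :
    0 < weakTypeConst p q s A C lam := by
  have := dyadicConst_pos (p := p) (q := q) (s := s) hA hC hlam
  have := sub_pos.2 (two_rpow_neg_div_lt_one h)
  unfold weakTypeConst
  positivity

namespace IsPoincarePair

variable (hug : IsPoincarePair p C lam μ u g)
include hug

theorem edist_average_closedBall_two_mul_le (hμ : IsGloballyAhlforsRegular s A μ)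
    (h : q.HolderTriple s p) (hC : 0 < C) (hlam : 0 < lam) (x : X) {r : ℝ} (hr : 0 < r) :
    edist (⨍ z in closedBall x r, u z ∂μ) (⨍ z in closedBall x (2 * r), u z ∂μ) ≤
      ENNReal.ofReal (dyadicConst p q s A C lam * r ^ (-(s / q))) *
        (∫⁻ z in ball x (4 * lam * r), g z ^ p ∂μ) ^ (1 / p) := by
  refine (hug.edist_average_closedBall_le hμ h hC hlam (R := 4 * r) (κ := 4) (y := x) hr
    (by positivity) (by positivity) (closedBall_subset_ball (by linarith))
    (closedBall_subset_ball (by linarith)) le_rfl (by linarith)).trans_eq ?_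
  rw [Real.mul_rpow (by norm_num) hr.le, dyadicConst]
  ring_nf

theorem edist_average_limit_le (hμ : IsGloballyAhlforsRegular s A μ)
    (h : q.HolderTriple s p) (hC : 0 < C) (hlam : 0 < lam) {x : X} {ρ c : ℝ} (hρ : 0 < ρ)
    (hc : Tendsto (fun n : ℕ => ⨍ z in closedBall x (ρ * 2 ^ n), u z ∂μ) atTop (𝓝 c)) :
    edist (⨍ z in closedBall x ρ, u z ∂μ) c ≤
      ENNReal.ofReal (dyadicConst p q s A C lam * (1 - 2 ^ (-(s / q)))⁻¹ * ρ ^ (-(s / q))) *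
        (∫⁻ z, g z ^ p ∂μ) ^ (1 / p) := by
  have hp := h.pos'
  have hratio := sub_pos.2 (two_rpow_neg_div_lt_one h)
  have hstep : ∀ n : ℕ, edist (⨍ z in closedBall x (ρ * 2 ^ n), u z ∂μ)
      (⨍ z in closedBall x (ρ * 2 ^ (n + 1)), u z ∂μ) ≤
        ENNReal.ofReal (dyadicConst p q s A C lam * ρ ^ (-(s / q))) *
          (∫⁻ z, g z ^ p ∂μ) ^ (1 / p) * ENNReal.ofReal (2 ^ (-(s / q))) ^ n := fun n => by
    rw [pow_succ' (2 : ℝ), mul_left_comm ρ]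
    refine (hug.edist_average_closedBall_two_mul_le hμ h hC hlam x (by positivity)).trans ?_
    rw [Real.mul_rpow hρ.le (by positivity), ← Real.rpow_pow_comm zero_le_two, ← mul_assoc,
      ENNReal.ofReal_mul' (by positivity), ENNReal.ofReal_pow (by positivity), mul_right_comm]
    gcongr
    exact Measure.restrict_le_self
  have hle := edist_le_of_edist_le_geometric_of_tendsto₀ _ _ hstep hc
  rw [pow_zero, mul_one] at hle
  refine hle.trans_eq ?_
  rw [ENNReal.div_eq_inv_mul, ← mul_assoc, ← ENNReal.ofReal_one,
    ← ENNReal.ofReal_sub _ (by positivity), ← ENNReal.ofReal_inv_of_pos hratio,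
    ← ENNReal.ofReal_mul (inv_nonneg.2 hratio.le)]
  ring_nf

theorem edist_average_closedBall_half_le (hμ : IsGloballyAhlforsRegular s A μ)
    (h : q.HolderTriple s p) (hC : 0 < C) (hlam : 0 < lam) {x : X} {ρ r : ℝ} {I : ℝ≥0∞}
    (hρ : 0 < ρ) (hr : 0 < r)
    (hx : ∀ r, 0 < r → ∫⁻ z in ball x r, g z ^ p ∂μ ≤ I * ENNReal.ofReal ((r / ρ) ^ s)) :
    edist (⨍ z in closedBall x (r / 2), u z ∂μ) (⨍ z in closedBall x r, u z ∂μ) ≤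
      ENNReal.ofReal (dyadicConst p q s A C lam * (4 * lam) ^ (s / p) * ρ ^ (-(s / q))) *
        I ^ (1 / p) * ENNReal.ofReal (r / ρ / 2) := by
  have hp := h.pos'
  have hD := dyadicConst_pos (p := p) (q := q) (s := s) hμ.pos hC hlam
  obtain ⟨t, ht, rfl⟩ : ∃ t, 0 < t ∧ r = 2 * (ρ * t) := ⟨r / ρ / 2, by positivity, by field_simp⟩
  have hexp : t ^ (-(s / q)) * t ^ (s / p) = t := by
    rw [← one_sub_div_eq_neg_div_of_holderTriple h, ← Real.rpow_add ht, sub_add_cancel,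
      Real.rpow_one]
  rw [mul_div_cancel_left₀ _ two_ne_zero]
  calc edist (⨍ z in closedBall x (ρ * t), u z ∂μ) (⨍ z in closedBall x (2 * (ρ * t)), u z ∂μ)
      ≤ ENNReal.ofReal (dyadicConst p q s A C lam * (ρ * t) ^ (-(s / q))) *
          (I * ENNReal.ofReal ((4 * lam * (ρ * t) / ρ) ^ s)) ^ (1 / p) := by
        refine (hug.edist_average_closedBall_two_mul_le hμ h hC hlam x (by positivity)).trans ?_
        gcongr
        exact hx _ (by positivity)
    _ = ENNReal.ofReal (dyadicConst p q s A C lam * (ρ * t) ^ (-(s / q))) *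
          (I ^ (1 / p) * ENNReal.ofReal ((4 * lam * t) ^ (s / p))) := by
        rw [ENNReal.mul_rpow_of_nonneg _ _ (by positivity),
          ENNReal.ofReal_rpow_of_nonneg (by positivity) (by positivity),
          ← Real.rpow_mul (by positivity), mul_one_div, mul_left_comm _ ρ,
          mul_div_cancel_left₀ _ hρ.ne']
    _ = ENNReal.ofReal (dyadicConst p q s A C lam * (4 * lam) ^ (s / p) * ρ ^ (-(s / q))) *
          I ^ (1 / p) * ENNReal.ofReal (t ^ (-(s / q)) * t ^ (s / p)) := by
        rw [mul_left_comm, ← ENNReal.ofReal_mul (by positivity), mul_right_comm _ (I ^ (1 / p)),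
          ← ENNReal.ofReal_mul (by positivity), mul_comm (I ^ (1 / p)),
          Real.mul_rpow hρ.le ht.le, Real.mul_rpow (by positivity) ht.le]
        ring_nf
    _ = _ := by
        rw [hexp, mul_div_assoc, mul_div_cancel_left₀ _ hρ.ne', mul_div_cancel_left₀ _ two_ne_zero]

theorem edist_average_of_setLIntegral_le (hμ : IsGloballyAhlforsRegular s A μ)
    (h : q.HolderTriple s p) (hC : 0 < C) (hlam : 0 < lam) {x : X} {ρ : ℝ} {I : ℝ≥0∞}
    (hρ : 0 < ρ)
    (hleb : Tendsto (fun r => ⨍ z in closedBall x r, u z ∂μ) (𝓝[>] 0) (𝓝 (u x)))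
    (hx : ∀ r, 0 < r → ∫⁻ z in ball x r, g z ^ p ∂μ ≤ I * ENNReal.ofReal ((r / ρ) ^ s)) :
    edist (⨍ z in closedBall x ρ, u z ∂μ) (u x) ≤
      ENNReal.ofReal (dyadicConst p q s A C lam * (4 * lam) ^ (s / p) * ρ ^ (-(s / q))) *
        I ^ (1 / p) := by
  have hstep : ∀ n : ℕ, edist (⨍ z in closedBall x (ρ / 2 ^ n), u z ∂μ)
      (⨍ z in closedBall x (ρ / 2 ^ (n + 1)), u z ∂μ) ≤
        ENNReal.ofReal (dyadicConst p q s A C lam * (4 * lam) ^ (s / p) * ρ ^ (-(s / q))) *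
          I ^ (1 / p) / 2 / 2 ^ n := fun n => by
    rw [edist_comm, pow_succ (2 : ℝ), ← div_div]
    refine (hug.edist_average_closedBall_half_le hμ h hC hlam hρ (by positivity) hx).trans_eq ?_
    rw [div_right_comm ρ, div_self hρ.ne', div_div, one_div (2 ^ n * 2),
      ENNReal.ofReal_inv_of_pos (by positivity), ENNReal.ofReal_mul (p := 2 ^ n) (by positivity),
      ENNReal.ofReal_pow zero_le_two, ENNReal.ofReal_ofNat,
      ENNReal.mul_inv (.inr ENNReal.ofNat_ne_top) (.inr two_ne_zero)]
    simp only [div_eq_mul_inv]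
    ring
  have hlim : Tendsto (fun n : ℕ => ρ / 2 ^ n) atTop (𝓝[>] 0) :=
    tendsto_nhdsWithin_iff.2 ⟨tendsto_const_nhds.div_atTop
      (tendsto_pow_atTop_atTop_of_one_lt one_lt_two), .of_forall fun n => by
        rw [mem_Ioi]; positivity⟩
  have hle := edist_le_of_edist_le_geometric_two_of_tendsto₀ _ hstep (hleb.comp hlim)
  rwa [pow_zero, div_one, ENNReal.mul_div_cancel two_ne_zero
    ENNReal.ofNat_ne_top] at hle

theorem edist_limit_le_of_setLIntegral_le (hμ : IsGloballyAhlforsRegular s A μ)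
    (h : q.HolderTriple s p) (hC : 0 < C) (hlam : 0 < lam) {x : X} {ρ c : ℝ} (hρ : 0 < ρ)
    (hc : Tendsto (fun n : ℕ => ⨍ z in closedBall x (ρ * 2 ^ n), u z ∂μ) atTop (𝓝 c))
    (hleb : Tendsto (fun r => ⨍ z in closedBall x r, u z ∂μ) (𝓝[>] 0) (𝓝 (u x)))
    (hx : ∀ r, 0 < r →
      ∫⁻ z in ball x r, g z ^ p ∂μ ≤ (∫⁻ z, g z ^ p ∂μ) * ENNReal.ofReal ((r / ρ) ^ s)) :
    edist (u x) c ≤ ENNReal.ofReal (weakTypeConst p q s A C lam * ρ ^ (-(s / q))) *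
      (∫⁻ z, g z ^ p ∂μ) ^ (1 / p) := by
  have hD := dyadicConst_pos (p := p) (q := q) (s := s) hμ.pos hC hlam
  have hratio := sub_pos.2 (two_rpow_neg_div_lt_one h)
  refine (edist_triangle_left _ _ (⨍ z in closedBall x ρ, u z ∂μ)).trans
    ((add_le_add (hug.edist_average_of_setLIntegral_le hμ h hC hlam hρ hleb hx)
      (hug.edist_average_limit_le hμ h hC hlam hρ hc)).trans_eq ?_)
  rw [← add_mul, ← ENNReal.ofReal_add (by positivity) (by positivity), weakTypeConst]
  ring_nf

end IsPoincarePair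

theorem measure_le_mul_lintegral_of_closedBall [BorelSpace X] [SecondCountableTopology X]
    {t : Set X} {r : X → ℝ} {ρ : ℝ} {K : ℝ≥0∞} {h : X → ℝ≥0∞} (hr : ∀ x ∈ t, 0 < r x)
    (hrρ : ∀ x ∈ t, r x ≤ ρ)
    (hK : ∀ x ∈ t, μ (closedBall x (5 * r x)) ≤ K * ∫⁻ y in closedBall x (r x), h y ∂μ) :
    μ t ≤ K * ∫⁻ x, h x ∂μ := by
  obtain ⟨v, hvt, hdisj, hcov⟩ := Vitali.exists_disjoint_subfamily_covering_enlargement_closedBall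
    t (fun x => x) r ρ hrρ 5 (by norm_num)
  have hcount : v.Countable := hdisj.countable_of_nonempty_interior fun x hx =>
    ⟨x, ball_subset_interior_closedBall (mem_ball_self (hr x (hvt hx)))⟩
  have htv : t ⊆ ⋃ x ∈ v, closedBall x (5 * r x) := fun x hx => by
    obtain ⟨b, hb, hsub⟩ := hcov x hx
    exact mem_biUnion hb (hsub (mem_closedBall_self (hr x hx).le))
  calc μ t ≤ ∑' x : v, μ (closedBall (x : X) (5 * r x)) :=
        (measure_mono htv).trans (measure_biUnion_le μ hcount _)
    _ ≤ ∑' x : v, K * ∫⁻ y in closedBall (x : X) (r x), h y ∂μ :=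
        ENNReal.tsum_le_tsum fun x => hK x (hvt x.2)
    _ = K * ∫⁻ y in ⋃ x ∈ v, closedBall x (r x), h y ∂μ := by
        rw [ENNReal.tsum_mul_left,
          lintegral_biUnion hcount (fun x _ => measurableSet_closedBall) hdisj]
    _ ≤ K * ∫⁻ x, h x ∂μ := by
        gcongr
        exact Measure.restrict_le_self

theorem IsGloballyAhlforsRegular.measure_exists_lt_setLIntegral_le [BorelSpace X]
    (hμ : IsGloballyAhlforsRegular s A μ) (hs : 0 < s) {h : X → ℝ≥0∞} (hh : ∫⁻ x, h x ∂μ ≠ ∞)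
    {ρ : ℝ} (hρ : 0 < ρ) :
    μ {x | ∃ r, 0 < r ∧
        (∫⁻ y, h y ∂μ) * ENNReal.ofReal ((r / ρ) ^ s) < ∫⁻ y in ball x r, h y ∂μ} ≤
      ENNReal.ofReal (A * 10 ^ s * ρ ^ s) := by
  have := hμ.secondCountableTopology
  have hA := hμ.pos
  set I := ∫⁻ y, h y ∂μ
  rcases eq_or_ne I 0 with hI | hI
  · have hempty : {x | ∃ r, 0 < r ∧ I * ENNReal.ofReal ((r / ρ) ^ s) <
        ∫⁻ y in ball x r, h y ∂μ} = ∅ := by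
      refine eq_empty_of_forall_notMem fun x ⟨r, _, hr⟩ => not_lt_zero (hr.trans_le ?_)
      exact (setLIntegral_le_lintegral _ _).trans_eq hI
    simp only [hempty, measure_empty, zero_le]
  choose! r hr hlt using fun x (hx : x ∈ {x | ∃ r, 0 < r ∧
    I * ENNReal.ofReal ((r / ρ) ^ s) < ∫⁻ y in ball x r, h y ∂μ}) => hx
  refine (measure_le_mul_lintegral_of_closedBall (h := h) (r := r) (ρ := ρ)
    (K := ENNReal.ofReal (A * 10 ^ s * ρ ^ s) / I) hr (fun x hx => ?_) fun x hx => ?_).trans_eq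
    (ENNReal.div_mul_cancel hI hh)
  · by_contra! hρr
    refine ((hlt x hx).trans_le (setLIntegral_le_lintegral _ _)).not_ge
      (le_mul_of_one_le_right' (ENNReal.one_le_ofReal.2 ?_))
    exact Real.one_le_rpow ((one_le_div hρ).2 hρr.le) hs.le
  · have hrx := hr x hx
    calc μ (closedBall x (5 * r x)) ≤ μ (ball x (10 * r x)) :=
          measure_mono (closedBall_subset_ball (by linarith))
      _ ≤ ENNReal.ofReal (A * (10 * r x) ^ s) := hμ.measure_ball_le x (by positivity)
      _ = ENNReal.ofReal (A * 10 ^ s * ρ ^ s) / I * (I * ENNReal.ofReal ((r x / ρ) ^ s)) := by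
          rw [← mul_assoc, ENNReal.div_mul_cancel hI hh, ← ENNReal.ofReal_mul (by positivity),
            Real.mul_rpow (by norm_num) hrx.le, Real.div_rpow hrx.le hρ.le]
          congr 1
          field_simp
      _ ≤ _ := by
          gcongr
          exact (hlt x hx).le.trans (lintegral_mono_set ball_subset_closedBall)

theorem exists_rpow_scale (hs : 0 < s) (hq : 0 < q) (p : ℝ) {W J t : ℝ} (hW : 0 < W)
    (hJ : 0 < J) (ht : 0 < t) :
    ∃ ρ, 0 < ρ ∧ W * ρ ^ (-(s / q)) * J ^ (1 / p) = t ∧ t ^ q * ρ ^ s = W ^ q * J ^ (q / p) := by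
  set b := W * J ^ (1 / p) / t with hb
  have hb_pos : 0 < b := by positivity
  have hbs : (b ^ (q / s)) ^ (-(s / q)) = b⁻¹ := by
    rw [← Real.rpow_mul hb_pos.le, ← Real.rpow_neg_one]
    congr 1
    field_simp
  refine ⟨b ^ (q / s), by positivity, ?_, ?_⟩
  · rw [hbs, mul_right_comm, hb, inv_div, mul_div_cancel₀ _ (by positivity)]
  · rw [← Real.rpow_mul hb_pos.le, div_mul_cancel₀ q hs.ne', Real.div_rpow (by positivity) ht.le,
      Real.mul_rpow hW.le (by positivity), ← Real.rpow_mul hJ.le, one_div_mul_eq_div]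
    field_simp

namespace IsPoincarePair

variable (hug : IsPoincarePair p C lam μ u g)
include hug

theorem locallyIntegrable : LocallyIntegrable u μ := fun x =>
  ⟨ball x 1, ball_mem_nhds x one_pos, hug.integrableOn_ball x 1⟩

theorem exists_measure_lt_edist_le [Nonempty X] [BorelSpace X]
    (hμ : IsGloballyAhlforsRegular s A μ) (h : q.HolderTriple s p) (hC : 0 < C) (hlam : 0 < lam)
    (hg : ∫⁻ z, g z ^ p ∂μ ≠ ∞) :
    ∃ c : ℝ, ∀ ρ, 0 < ρ →
      μ {x | ENNReal.ofReal (weakTypeConst p q s A C lam * ρ ^ (-(s / q))) *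
          (∫⁻ z, g z ^ p ∂μ) ^ (1 / p) < edist (u x) c} ≤ ENNReal.ofReal (A * 10 ^ s * ρ ^ s) := by
  have := hμ.isUnifLocDoublingMeasure
  have := hμ.isLocallyFiniteMeasure
  have := hμ.secondCountableTopology
  obtain ⟨c, hc⟩ := hug.exists_tendsto_average hμ h hC hlam hg
  refine ⟨c, fun ρ hρ =>
    (measure_mono_ae ?_).trans (hμ.measure_exists_lt_setLIntegral_le h.symm.pos hg hρ)⟩
  filter_upwards [IsUnifLocDoublingMeasure.ae_tendsto_average μ hug.locallyIntegrable 1]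
    with x hleb hlt
  have hlim := hleb (fun _ => x) id tendsto_id <| eventually_mem_nhdsWithin.mono fun r hr =>
    mem_closedBall_self (by simpa using (mem_Ioi.1 hr).le)
  by_contra hsmall
  refine not_le_of_gt hlt (hug.edist_limit_le_of_setLIntegral_le hμ h hC hlam hρ (hc x hρ) hlim
    fun r hr => le_of_not_gt fun hr' => hsmall ⟨r, hr, hr'⟩)

theorem exists_measure_lt_abs_sub_le [Nonempty X] [BorelSpace X]
    (hμ : IsGloballyAhlforsRegular s A μ) (h : q.HolderTriple s p) (hC : 0 < C) (hlam : 0 < lam)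
    (hg : ∫⁻ z, g z ^ p ∂μ ≠ ∞) :
    ∃ c : ℝ, ∀ t ρ, 0 < t → 0 < ρ →
      weakTypeConst p q s A C lam * ρ ^ (-(s / q)) * (∫⁻ z, g z ^ p ∂μ).toReal ^ (1 / p) ≤ t →
        μ {x | t < |u x - c|} ≤ ENNReal.ofReal (A * 10 ^ s * ρ ^ s) := by
  have hp := h.pos'
  have hW := weakTypeConst_pos h hμ.pos hC hlam
  obtain ⟨c, hc⟩ := hug.exists_measure_lt_edist_le hμ h hC hlam hg
  refine ⟨c, fun t ρ ht hρ hle => (measure_mono fun x hx => ?_).trans (hc ρ hρ)⟩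
  rw [mem_ofPred_eq, ← ENNReal.ofReal_toReal hg,
    ENNReal.ofReal_rpow_of_nonneg ENNReal.toReal_nonneg (by positivity),
    ← ENNReal.ofReal_mul (by positivity), edist_dist, Real.dist_eq]
  exact (ENNReal.ofReal_lt_ofReal_iff (ht.trans hx)).2 (hle.trans_lt hx)

theorem exists_rpow_mul_measure_lt_le [Nonempty X] [BorelSpace X]
    (hμ : IsGloballyAhlforsRegular s A μ) (h : q.HolderTriple s p) (hC : 0 < C) (hlam : 0 < lam)
    (hg : ∫⁻ z, g z ^ p ∂μ ≠ ∞) :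
    ∃ c : ℝ, ∀ t, 0 < t → ENNReal.ofReal t ^ q * μ {x | t < |u x - c|} ≤
      ENNReal.ofReal (A * 10 ^ s * weakTypeConst p q s A C lam ^ q) *
        (∫⁻ z, g z ^ p ∂μ) ^ (q / p) := by
  have hA := hμ.pos
  have hs := h.symm.pos
  have hq := h.pos
  have hp := h.pos'
  have hW := weakTypeConst_pos h hA hC hlam
  obtain ⟨c, hc⟩ := hug.exists_measure_lt_abs_sub_le hμ h hC hlam hg
  set W := weakTypeConst p q s A C lam
  set J := (∫⁻ z, g z ^ p ∂μ).toReal with hJ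
  refine ⟨c, fun t ht => ?_⟩
  rcases eq_or_lt_of_le' (hJ ▸ ENNReal.toReal_nonneg : 0 ≤ J) with hJ0 | hJ0
  · have hlim : Tendsto (fun ρ : ℝ => ENNReal.ofReal (A * 10 ^ s * ρ ^ s)) (𝓝[>] 0) (𝓝 0) := by
      have hcont := (Real.continuousAt_rpow_const 0 s (.inr hs.le)).tendsto.const_mul (A * 10 ^ s)
      rw [Real.zero_rpow hs.ne', mul_zero] at hcont
      simpa using ENNReal.tendsto_ofReal (hcont.mono_left nhdsWithin_le_nhds)
    have hzero : μ {x | t < |u x - c|} ≤ 0 := by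
      refine ge_of_tendsto hlim (eventually_mem_nhdsWithin.mono fun ρ hρ => hc t ρ ht hρ ?_)
      rw [hJ0, Real.zero_rpow (by positivity), mul_zero]
      exact ht.le
    rw [nonpos_iff_eq_zero.1 hzero, mul_zero]
    exact zero_le
  · obtain ⟨ρ, hρ, hρt, hρs⟩ := exists_rpow_scale hs hq p hW hJ0 ht
    rw [← ENNReal.ofReal_toReal hg, ← hJ, ENNReal.ofReal_rpow_of_pos hJ0,
      ENNReal.ofReal_rpow_of_pos ht, ← ENNReal.ofReal_mul (by positivity), mul_assoc, ← hρs,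
      mul_left_comm, ENNReal.ofReal_mul (by positivity)]
    gcongr
    exact hc t ρ ht hρ hρt.le

end IsPoincarePair

end WeakType

section LocalIntegrability

theorem aemeasurable_liminf_atTop {α : Type*} [MeasurableSpace α] {ν : Measure α}
    {F : ℕ → α → ℝ≥0∞} (hF : ∀ k, AEMeasurable (F k) ν) :
    AEMeasurable (fun x => liminf (fun k => F k x) atTop) ν := by
  simp only [liminf_eq_iSup_iInf_of_nat]
  exact .iSup fun _ => .biInf _ (to_countable _) fun k _ => hF k

theorem integrable_of_tendsto_of_lintegral_enorm_sub_le {α E : Type*} [MeasurableSpace α]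
    [NormedAddCommGroup E] {ν : Measure α} [IsFiniteMeasure ν] {F : ℕ → α → E} {f : α → E}
    {a : ℕ → E} (hF : ∀ k, AEStronglyMeasurable (F k) ν)
    (hlim : ∀ᵐ x ∂ν, Tendsto (fun k => F k x) atTop (𝓝 (f x))) {M : ℝ≥0∞} (hM : M ≠ ∞)
    (hbound : ∀ k, ∫⁻ x, ‖F k x - a k‖ₑ ∂ν ≤ M) : Integrable f ν := by
  rcases eq_or_ne ν 0 with rfl | hν
  · exact integrable_zero_measure
  have : (ae ν).NeBot := ae_neBot.2 hν
  have hmeas : ∀ k, AEMeasurable (fun x => ‖F k x - a k‖ₑ) ν := fun k =>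
    ((hF k).sub aestronglyMeasurable_const).enorm
  have hliminf : ∀ᵐ x ∂ν, liminf (fun k => ‖F k x - a k‖ₑ) atTop < ∞ := by
    refine ae_lt_top' (aemeasurable_liminf_atTop hmeas) (ne_top_of_le_ne_top hM ?_)
    exact (lintegral_liminf_le' hmeas).trans
      (liminf_le_of_frequently_le' (Frequently.of_forall hbound))
  obtain ⟨x, hx, hx_lim⟩ := (hliminf.and hlim).exists
  obtain ⟨B, hxB, hB⟩ := exists_between hx
  have ha : ∃ᶠ k in atTop, ‖a k‖ₑ ≤ ‖f x‖ₑ + 1 + B := by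
    have hFx : ∀ᶠ k in atTop, ‖F k x‖ₑ < ‖f x‖ₑ + 1 :=
      hx_lim.enorm.eventually_lt_const (ENNReal.lt_add_right enorm_ne_top one_ne_zero)
    refine ((frequently_lt_of_liminf_lt (by isBoundedDefault) hxB).and_eventually hFx).mono
      fun k hk => ?_
    calc ‖a k‖ₑ = ‖F k x - (F k x - a k)‖ₑ := by rw [sub_sub_cancel]
      _ ≤ ‖F k x‖ₑ + ‖F k x - a k‖ₑ := enorm_sub_le
      _ ≤ ‖f x‖ₑ + 1 + B := add_le_add hk.2.le hk.1.le
  have hfreq : ∃ᶠ k in atTop, eLpNorm (F k) 1 ν ≤ M + (‖f x‖ₑ + 1 + B) * ν univ := by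
    refine ha.mono fun k hk => ?_
    calc eLpNorm (F k) 1 ν = ∫⁻ y, ‖F k y - a k + a k‖ₑ ∂ν := by
          simp only [sub_add_cancel, eLpNorm_one_eq_lintegral_enorm]
      _ ≤ ∫⁻ y, ‖F k y - a k‖ₑ + ‖a k‖ₑ ∂ν := lintegral_mono fun y => enorm_add_le _ _
      _ = ∫⁻ y, ‖F k y - a k‖ₑ ∂ν + ‖a k‖ₑ * ν univ := by
          rw [lintegral_add_right _ measurable_const, lintegral_const]
      _ ≤ M + (‖f x‖ₑ + 1 + B) * ν univ := by gcongr; exact hbound k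
  refine memLp_one_iff_integrable.1 ⟨aestronglyMeasurable_of_tendsto_ae _ hF hlim, ?_⟩
  refine (Lp.eLpNorm_lim_le_liminf_eLpNorm hF f hlim).trans_lt
    ((liminf_le_of_frequently_le' hfreq).trans_lt ?_)
  finiteness

theorem memL1loc_coe {X : Type*} [MetricSpace X] [MeasurableSpace X] {μ : Measure X} {u : X → ℝ}
    (hu : LocallyIntegrable u μ) : MemL1loc μ fun x => (u x : EReal) :=
  ⟨.of_forall fun x => ⟨EReal.coe_ne_top _, EReal.coe_ne_bot _⟩, by simpa using hu⟩

theorem tendsto_projIcc_neg_natCast (x : ℝ) :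
    Tendsto (fun k : ℕ => (projIcc (-k : ℝ) k (neg_le_self k.cast_nonneg) x : ℝ)) atTop (𝓝 x) := by
  obtain ⟨N, hN⟩ := exists_nat_ge |x|
  refine tendsto_const_nhds.congr' ((eventually_ge_atTop N).mono fun k hk => ?_)
  exact (congrArg Subtype.val (projIcc_of_mem _ (abs_le.1 (hN.trans (Nat.cast_le.2 hk))))).symm

variable {X : Type*} [MetricSpace X] [MeasurableSpace X] {μ : Measure X} {s A p : ℝ} {f : X → ℝ}
  {g : X → ℝ≥0∞}

theorem IsUpperGradient.integrableOn_ball [BorelSpace X] (hμ : IsGloballyAhlforsRegular s A μ)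
    (hf : AEMeasurable f μ) (hg : IsUpperGradient (fun x => (f x : EReal)) g) {x : X} {r : ℝ}
    (hr : 0 < r) {D : ℝ≥0∞} (hD : D ≠ ∞)
    (hosc : ∀ u : X → ℝ, LocallyIntegrable u μ → IsUpperGradient (fun y => (u y : EReal)) g →
      ⨍⁻ y in ball x r, ‖u y - ⨍ z in ball x r, u z ∂μ‖ₑ ∂μ ≤ D) :
    IntegrableOn f (ball x r) μ := by
  have := hμ.isLocallyFiniteMeasure
  have hball := (hμ.measure_ball_lt_top x r).ne
  have : IsFiniteMeasure (μ.restrict (ball x r)) := isFiniteMeasure_restrict.2 hball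
  set F : ℕ → X → ℝ := fun k y => projIcc (-k : ℝ) k (neg_le_self k.cast_nonneg) (f y)
  have hF_meas : ∀ k, AEStronglyMeasurable (F k) μ := fun k =>
    (measurable_subtype_coe.comp continuous_projIcc.measurable |>.comp_aemeasurable
      hf).aestronglyMeasurable
  have hF_loc : ∀ k, LocallyIntegrable (F k) μ := fun k =>
    (locallyIntegrable_const (k : ℝ)).mono (hF_meas k) (.of_forall fun y => by
      simpa using abs_le.2 (projIcc (-k : ℝ) k (neg_le_self k.cast_nonneg) (f y)).2)
  have hF_grad : ∀ k, IsUpperGradient (fun y => (F k y : EReal)) g := fun k =>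
    hg.of_abs_sub_le fun y z => abs_projIcc_sub_projIcc _
  refine integrable_of_tendsto_of_lintegral_enorm_sub_le (F := F)
    (a := fun k => ⨍ z in ball x r, F k z ∂μ) (M := D * μ (ball x r))
    (fun k => (hF_meas k).restrict) (.of_forall fun y => tendsto_projIcc_neg_natCast (f y))
    (ENNReal.mul_ne_top hD hball) fun k => ?_
  have hk := hosc (F k) (hF_loc k) (hF_grad k)
  rw [setLAverage_eq] at hk
  exact (ENNReal.div_le_iff (hμ.measure_ball_pos x hr).ne' hball).1 hk

theorem exists_isPoincarePair [BorelSpace X] (hμ : IsGloballyAhlforsRegular s A μ) (hp : 0 < p)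
    (hP : SupportsGlobalPoincare p μ) :
    ∃ C lam : ℝ, 0 < C ∧ 0 < lam ∧ ∀ (f : X → ℝ) (g : X → ℝ≥0∞), AEMeasurable f μ →
      IsUpperGradient (fun x => (f x : EReal)) g → ∫⁻ x, g x ^ p ∂μ ≠ ∞ →
        IsPoincarePair p C lam μ f g := by
  obtain ⟨C, lam, hC, hlam, hP⟩ := hP
  refine ⟨C, lam, hC, hlam, fun f g hf hg hgp => ?_⟩
  have hosc : ∀ x r, 0 < r → ∀ u : X → ℝ, LocallyIntegrable u μ →
      IsUpperGradient (fun y => (u y : EReal)) g →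
        ⨍⁻ y in ball x r, ‖u y - ⨍ z in ball x r, u z ∂μ‖ₑ ∂μ ≤
          ENNReal.ofReal (C * r) * (⨍⁻ y in ball x (lam * r), g y ^ p ∂μ) ^ (1 / p) :=
    fun x r hr u hu hug => by simpa using hP x r hr _ g (memL1loc_coe hu) hug
  have hball : ∀ x r, 0 < r → IntegrableOn f (ball x r) μ := fun x r hr => by
    refine hg.integrableOn_ball hμ hf hr (ENNReal.mul_ne_top ENNReal.ofReal_ne_top
      (ENNReal.rpow_ne_top_of_nonneg (by positivity) ?_)) (hosc x r hr)
    rw [setLAverage_eq]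
    exact ENNReal.div_ne_top (ne_top_of_le_ne_top hgp (setLIntegral_le_lintegral _ _))
      (hμ.measure_ball_pos x (mul_pos hlam hr)).ne'
  refine ⟨fun x r => (hball x (max r 1) (by positivity)).mono_set
    (ball_subset_ball (le_max_left r 1)), fun x r hr => hosc x r hr f (fun y => ?_) hg⟩
  exact ⟨ball y 1, ball_mem_nhds y one_pos, hball y 1 one_pos⟩

end LocalIntegrability

section StrongType

theorem tsum_rpow_le_rpow_tsum {ι : Type*} (a : ι → ℝ≥0∞) {r : ℝ} (hr : 1 ≤ r) :
    ∑' i, a i ^ r ≤ (∑' i, a i) ^ r := by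
  have hsplit : ∀ z : ℝ≥0∞, z ^ r = z ^ (r - 1) * z := fun z => by
    conv_lhs => rw [← sub_add_cancel r 1]
    rw [ENNReal.rpow_add_of_nonneg _ _ (sub_nonneg.2 hr) zero_le_one, ENNReal.rpow_one]
  rw [hsplit, ← ENNReal.tsum_mul_left]
  refine ENNReal.tsum_le_tsum fun i => ?_
  rw [hsplit]
  gcongr
  exact ENNReal.le_tsum i

theorem lintegral_ofReal_rpow_le_tsum_zpow {α : Type*} [MeasurableSpace α] {μ : Measure α}
    {v : α → ℝ} (hv : AEMeasurable v μ) {q : ℝ} (hq : 0 < q) :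
    ∫⁻ x, ENNReal.ofReal (v x) ^ q ∂μ ≤
      ∑' k : ℤ, ENNReal.ofReal (2 ^ (k + 1)) ^ q * μ {x | 2 ^ k ≤ v x} := by
  have hlevel : ∀ k : ℤ, NullMeasurableSet {x | (2 : ℝ) ^ k ≤ v x} μ := fun k =>
    hv.nullMeasurable measurableSet_Ici
  calc ∫⁻ x, ENNReal.ofReal (v x) ^ q ∂μ
      ≤ ∫⁻ x, ∑' k : ℤ, {x | (2 : ℝ) ^ k ≤ v x}.indicator
          (fun _ => ENNReal.ofReal (2 ^ (k + 1)) ^ q) x ∂μ := by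
        refine lintegral_mono fun x => ?_
        rcases le_or_gt (v x) 0 with hx | hx
        · rw [ENNReal.ofReal_of_nonpos hx, ENNReal.zero_rpow_of_pos hq]
          exact zero_le
        · obtain ⟨n, hn, hn'⟩ := exists_mem_Ico_zpow hx (one_lt_two (α := ℝ))
          refine le_trans ?_ (ENNReal.le_tsum n)
          rw [indicator_of_mem (show x ∈ {x | (2 : ℝ) ^ n ≤ v x} from hn)]
          gcongr
    _ = ∑' k : ℤ, ENNReal.ofReal (2 ^ (k + 1)) ^ q * μ {x | 2 ^ k ≤ v x} := by
        rw [lintegral_tsum fun k => aemeasurable_const.indicator₀ (hlevel k)]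
        exact tsum_congr fun k => lintegral_indicator_const₀ (hlevel k) _

theorem eq_of_measure_ne_lt_top {α : Type*} [MeasurableSpace α] {μ : Measure α}
    (hμ : μ univ = ∞) {w : α → ℝ} {a c : ℝ} (ha : μ {x | w x ≠ a} < ∞)
    (hc : ∀ t, 0 < t → μ {x | t < |w x - c|} < ∞) : c = a := by
  by_contra! hne
  have hpos : 0 < |a - c| := abs_pos.2 (sub_ne_zero.2 hne.symm)
  have hcover : univ ⊆ {x | w x ≠ a} ∪ {x | |a - c| / 2 < |w x - c|} := fun x _ => by
    rcases eq_or_ne (w x) a with hx | hx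
    · exact .inr (by rw [mem_ofPred_eq, hx]; exact half_lt_self hpos)
    · exact .inl hx
  have hfin : μ univ < ∞ := (measure_mono hcover).trans_lt
    ((measure_union_le _ _).trans_lt (ENNReal.add_lt_top.2 ⟨ha, hc _ (half_pos hpos)⟩))
  exact hfin.ne hμ

variable {X : Type*} [MetricSpace X] [MeasurableSpace X] {μ : Measure X} {p q s A : ℝ} {K : ℝ≥0∞}

/-- The weak type `(p, q)` Sobolev inequality with constant `K`: every function with a
`p`-integrable upper gradient lies, up to a constant, in weak `L^q`. -/
def WeakSobolev (p q : ℝ) (K : ℝ≥0∞) (μ : Measure X) : Prop :=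
  ∀ (u : X → ℝ) (g : X → ℝ≥0∞), AEMeasurable u μ → IsUpperGradient (fun x => (u x : EReal)) g →
    ∫⁻ x, g x ^ p ∂μ ≠ ∞ → ∃ c : ℝ, ∀ t, 0 < t →
      ENNReal.ofReal t ^ q * μ {x | t < |u x - c|} ≤ K * (∫⁻ x, g x ^ p ∂μ) ^ (q / p)

theorem IsGloballyAhlforsRegular.exists_weakSobolev [Nonempty X] [BorelSpace X]
    (hμ : IsGloballyAhlforsRegular s A μ) (h : q.HolderTriple s p)
    (hP : SupportsGlobalPoincare p μ) : ∃ K, K ≠ ∞ ∧ WeakSobolev p q K μ := by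
  obtain ⟨C, lam, hC, hlam, hpair⟩ := exists_isPoincarePair hμ h.pos' hP
  exact ⟨_, ENNReal.ofReal_ne_top, fun u g hu hug hg =>
    (hpair u g hu hug hg).exists_rpow_mul_measure_lt_le hμ h hC hlam hg⟩

theorem lt_top_of_ofReal_rpow_mul_le {t q : ℝ} {m M : ℝ≥0∞} (ht : 0 < t) (hM : M ≠ ∞)
    (h : ENNReal.ofReal t ^ q * m ≤ M) : m < ∞ :=
  ENNReal.lt_top_of_mul_ne_top_right (ne_top_of_le_ne_top hM h)
    (ENNReal.rpow_pos (ENNReal.ofReal_pos.2 ht) ENNReal.ofReal_ne_top).ne'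

namespace WeakSobolev

variable [BorelSpace X] {v : X → ℝ} {g : X → ℝ≥0∞} (hW : WeakSobolev p q K μ)
include hW

theorem rpow_mul_measure_le_add (hp : 0 < p) (hq : 0 < q) (hK : K ≠ ∞) (hμ : μ univ = ∞)
    (hv : AEMeasurable v μ) (hvg : IsUpperGradient (fun x => (v x : EReal)) g)
    (hg : ∫⁻ x, g x ^ p ∂μ ≠ ∞) {α β : ℝ} (hαβ : α < β) (hα : μ {x | α < v x} < ∞)
    {S : Set X} (hS : MeasurableSet S) (hsub : v ⁻¹' Ioo α β ⊆ S) {ε : ℝ≥0∞} (hε : ε ≠ 0)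
    (hε' : ε ≠ ∞) :
    ENNReal.ofReal ((β - α) / 2) ^ q * μ {x | β ≤ v x} ≤
      K * ((1 + ε) ^ p * ∫⁻ x in S, g x ^ p ∂μ + ε ^ p * ∫⁻ x, g x ^ p ∂μ) ^ (q / p) := by
  have hmid : 0 < (β - α) / 2 := half_pos (sub_pos.2 hαβ)
  have henergy := lintegral_rpow_indicator_add_const_mul_le μ (g := g) hS hp.le hε'
  have henergy_fin : ∫⁻ x, (S.indicator g x + ε * g x) ^ p ∂μ ≠ ∞ := by
    have : ∫⁻ x in S, g x ^ p ∂μ ≠ ∞ := ne_top_of_le_ne_top hg (setLIntegral_le_lintegral _ _)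
    exact ne_top_of_le_ne_top (by finiteness) henergy
  set w : X → ℝ := fun x => projIcc α β hαβ.le (v x)
  have hwm : AEMeasurable w μ :=
    (measurable_subtype_coe.comp continuous_projIcc.measurable).comp_aemeasurable hv
  obtain ⟨c, hc⟩ := hW w _ hwm (hvg.truncate hαβ.le hS hsub hε) henergy_fin
  have hw_ne : {x | w x ≠ α} ⊆ {x | α < v x} := fun x hx => by
    by_contra hle
    exact hx (congrArg Subtype.val (projIcc_of_le_left hαβ.le (not_lt.1 hle)))
  have hcα : c = α := eq_of_measure_ne_lt_top hμ ((measure_mono hw_ne).trans_lt hα) fun t ht =>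
    lt_top_of_ofReal_rpow_mul_le ht (by finiteness) (hc t ht)
  calc ENNReal.ofReal ((β - α) / 2) ^ q * μ {x | β ≤ v x}
      ≤ ENNReal.ofReal ((β - α) / 2) ^ q * μ {x | (β - α) / 2 < |w x - c|} := by
        gcongr with x
        intro hx
        have hwx : w x = β := congrArg Subtype.val (projIcc_of_right_le hαβ.le hx)
        rw [hwx, hcα, abs_of_pos (sub_pos.2 hαβ)]
        exact half_lt_self (sub_pos.2 hαβ)
    _ ≤ K * (∫⁻ x, (S.indicator g x + ε * g x) ^ p ∂μ) ^ (q / p) := hc _ hmid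
    _ ≤ _ := by gcongr

theorem rpow_mul_measure_le (hp : 0 < p) (hq : 0 < q) (hK : K ≠ ∞) (hμ : μ univ = ∞)
    (hv : AEMeasurable v μ) (hvg : IsUpperGradient (fun x => (v x : EReal)) g)
    (hg : ∫⁻ x, g x ^ p ∂μ ≠ ∞) {α β : ℝ} (hαβ : α < β) (hα : μ {x | α < v x} < ∞) :
    ENNReal.ofReal ((β - α) / 2) ^ q * μ {x | β ≤ v x} ≤
      K * (∫⁻ x in v ⁻¹' Ioo α β, g x ^ p ∂μ) ^ (q / p) := by
  have hlayer : μ (v ⁻¹' Ioo α β) ≠ ∞ := ((measure_mono fun x hx => hx.1).trans_lt hα).ne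
  have hlayer_fin : ∫⁻ x in v ⁻¹' Ioo α β, g x ^ p ∂μ ≠ ∞ :=
    ne_top_of_le_ne_top hg (setLIntegral_le_lintegral _ _)
  set I := ∫⁻ x in v ⁻¹' Ioo α β, g x ^ p ∂μ with hI
  set J := ∫⁻ x, g x ^ p ∂μ
  have hbound : ∀ᶠ ε in 𝓝[>] (0 : ℝ≥0∞), ENNReal.ofReal ((β - α) / 2) ^ q * μ {x | β ≤ v x} ≤
      K * ((1 + ε) ^ p * I + ε ^ p * J) ^ (q / p) := by
    filter_upwards [self_mem_nhdsWithin,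
      mem_nhdsWithin_of_mem_nhds (Iio_mem_nhds ENNReal.zero_lt_top)] with ε hε hε'
    rw [hI, ← Measure.restrict_toMeasurable hlayer]
    exact hW.rpow_mul_measure_le_add hp hq hK hμ hv hvg hg hαβ hα
      (measurableSet_toMeasurable μ _) (subset_toMeasurable μ _) hε.ne' hε'.ne
  refine ge_of_tendsto (Tendsto.mono_left ?_ nhdsWithin_le_nhds) hbound
  have hone : Tendsto (fun ε : ℝ≥0∞ => (1 + ε) ^ p) (𝓝 0) (𝓝 1) :=
    (ENNReal.continuous_rpow_const.comp (continuous_const.add continuous_id)).tendsto' _ _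
      (by simp)
  have hzero : Tendsto (fun ε : ℝ≥0∞ => ε ^ p) (𝓝 0) (𝓝 0) :=
    ENNReal.continuous_rpow_const.tendsto' _ _ (ENNReal.zero_rpow_of_pos hp)
  have hlim : Tendsto (fun ε : ℝ≥0∞ => (1 + ε) ^ p * I + ε ^ p * J) (𝓝 0) (𝓝 I) := by
    simpa using (ENNReal.Tendsto.mul_const hone (.inr hlayer_fin)).add
      (ENNReal.Tendsto.mul_const hzero (.inr hg))
  exact ENNReal.Tendsto.const_mul ((ENNReal.continuous_rpow_const.tendsto _).comp hlim) (.inr hK)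

theorem lintegral_rpow_le (hp : 0 < p) (hpq : p ≤ q) (hK : K ≠ ∞) (hμ : μ univ = ∞)
    (hv : AEMeasurable v μ) (hvg : IsUpperGradient (fun x => (v x : EReal)) g)
    (hg : ∫⁻ x, g x ^ p ∂μ ≠ ∞) (hfin : ∀ t, 0 < t → μ {x | t < v x} < ∞) :
    ∫⁻ x, ENNReal.ofReal (v x) ^ q ∂μ ≤ 8 ^ q * K * (∫⁻ x, g x ^ p ∂μ) ^ (q / p) := by
  have hq := hp.trans_le hpq
  set L : ℤ → Set X := fun k => v ⁻¹' Ioo (2 ^ (k - 1)) (2 ^ k)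
  have hL_null : ∀ k, NullMeasurableSet (L k) μ := fun k => hv.nullMeasurable measurableSet_Ioo
  have hL_disj : Pairwise (Function.onFun (AEDisjoint μ) L) := fun i j hij =>
    (((zpow_right_mono₀ one_le_two).pairwise_disjoint_on_Ioo_pred hij).preimage v).aedisjoint
  have hlevel : ∀ k : ℤ, ENNReal.ofReal (2 ^ (k + 1)) ^ q * μ {x | 2 ^ k ≤ v x} ≤
      8 ^ q * K * (∫⁻ x in L k, g x ^ p ∂μ) ^ (q / p) := fun k => by
    have hk : (2 : ℝ) ^ (k - 1) < 2 ^ k := zpow_lt_zpow_right₀ one_lt_two (sub_one_lt k)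
    have hscale : ENNReal.ofReal (2 ^ (k + 1)) ^ q =
        8 ^ q * ENNReal.ofReal ((2 ^ k - 2 ^ (k - 1)) / 2) ^ q := by
      rw [← ENNReal.mul_rpow_of_nonneg _ _ hq.le, ← ENNReal.ofReal_ofNat 8,
        ← ENNReal.ofReal_mul (by norm_num), zpow_add_one₀ two_ne_zero, zpow_sub_one₀ two_ne_zero]
      ring_nf
    rw [hscale, mul_assoc, mul_assoc]
    refine mul_le_mul_right ?_ _
    exact hW.rpow_mul_measure_le hp hq hK hμ hv hvg hg hk (hfin _ (by positivity))
  calc ∫⁻ x, ENNReal.ofReal (v x) ^ q ∂μ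
      ≤ ∑' k : ℤ, ENNReal.ofReal (2 ^ (k + 1)) ^ q * μ {x | 2 ^ k ≤ v x} :=
        lintegral_ofReal_rpow_le_tsum_zpow hv hq
    _ ≤ ∑' k : ℤ, 8 ^ q * K * (∫⁻ x in L k, g x ^ p ∂μ) ^ (q / p) := ENNReal.tsum_le_tsum hlevel
    _ ≤ 8 ^ q * K * (∑' k : ℤ, ∫⁻ x in L k, g x ^ p ∂μ) ^ (q / p) := by
        rw [ENNReal.tsum_mul_left]
        gcongr
        exact tsum_rpow_le_rpow_tsum _ ((one_le_div hp).2 hpq)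
    _ ≤ 8 ^ q * K * (∫⁻ x, g x ^ p ∂μ) ^ (q / p) := by
        rw [← lintegral_iUnion₀ hL_null hL_disj]
        gcongr
        exact Measure.restrict_le_self

theorem exists_memLp_sub_const (hp : 0 < p) (hpq : p ≤ q) (hK : K ≠ ∞) (hμ : μ univ = ∞)
    {f : X → ℝ} (hf : AEMeasurable f μ) (hfg : IsUpperGradient (fun x => (f x : EReal)) g)
    (hg : ∫⁻ x, g x ^ p ∂μ ≠ ∞) :
    ∃ c : ℝ, MemLp (fun x => f x - c) (ENNReal.ofReal q) μ := by
  have hq := hp.trans_le hpq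
  obtain ⟨c, hc⟩ := hW f g hf hfg hg
  have hfin : ∀ t, 0 < t → μ {x | t < |f x - c|} < ∞ := fun t ht =>
    lt_top_of_ofReal_rpow_mul_le ht (by finiteness) (hc t ht)
  have habs : IsUpperGradient (fun x => ((|f x - c| : ℝ) : EReal)) g :=
    hfg.of_abs_sub_le fun x y => by simpa using abs_abs_sub_abs_le_abs_sub (f x - c) (f y - c)
  have hle := hW.lintegral_rpow_le hp hpq hK hμ
    (continuous_abs.measurable.comp_aemeasurable (hf.sub_const c)) habs hg hfin
  refine ⟨c, (hf.sub_const c).aestronglyMeasurable, ?_⟩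
  rw [eLpNorm_lt_top_iff_lintegral_rpow_enorm_lt_top (by simpa using hq) ENNReal.ofReal_ne_top,
    ENNReal.toReal_ofReal hq.le]
  simp only [Real.enorm_eq_ofReal_abs]
  exact hle.trans_lt (by finiteness)

end WeakSobolev

end StrongType

end Dirichlet

theorem mainTheorem12_general {X : Type*} [MetricSpace X] [MeasurableSpace X] [BorelSpace X]
    (μ : Measure X) (hμ_univ : μ univ = ⊤) {p q s : ℝ} (h : q.HolderTriple s p)
    (hAhlfors : Dirichlet.IsAhlforsRegular s μ) (hPoincare : Dirichlet.SupportsGlobalPoincare p μ)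
    (f : X → ℝ) (hf : Dirichlet.MemDirichlet p μ f) :
    ∃ c : ℝ, MemLp (fun x => f x - c) (ENNReal.ofReal q) μ := by
  obtain ⟨hfm, g, hg, hgp⟩ := hf
  rcases subsingleton_or_nontrivial X with hX | hX
  · obtain ⟨x⟩ : Nonempty X := by
      by_contra! hempty
      simp [Set.univ_eq_empty_iff.2 hempty] at hμ_univ
    exact ⟨f x, by simp [Subsingleton.elim _ x]⟩
  · obtain ⟨A, hA⟩ := hAhlfors.exists_isGloballyAhlforsRegular hμ_univ
    obtain ⟨K, hK, hW⟩ := hA.exists_weakSobolev h hPoincare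
    exact hW.exists_memLp_sub_const h.pos' h.lt.le hK hμ_univ hfm hg hgp.ne

theorem mainTheorem12 {X : Type*} [MetricSpace X] [ProperSpace X] [ConnectedSpace X]
    [MeasurableSpace X] [BorelSpace X] (μ : MeasureTheory.Measure X)
    (hμ_univ : μ Set.univ = ⊤)
    (hμ_ball : ∀ (x : X) (r : ℝ), 0 < r →
      0 < μ (Metric.ball x r) ∧ μ (Metric.ball x r) < ⊤)
    (p q s : ℝ) (hp : 1 ≤ p) (hps : p < s) (hq : 1 < q) (hpqs : 1 / q + 1 / s = 1 / p)
    (hAhlfors : Dirichlet.IsAhlforsRegular s μ)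
    (hcontrolled : Dirichlet.IsGloballyControlled p μ)
    (f : X → ℝ) (hf : Dirichlet.MemDirichlet p μ f) :
    ∃ c : ℝ, MeasureTheory.MemLp (fun x => f x - c) (ENNReal.ofReal q) μ := by
  exact mainTheorem12_general μ hμ_univ
    (⟨by simpa using hpqs, by linarith, by linarith⟩ : q.HolderTriple s p)
    hAhlfors hcontrolled.2 f hf
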